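/- Let $k$ be a commutative ring. Let $\mathrm{OA}$ (resp. $\mathrm{BA}$) be the category with objects $[n]=\{1,\dots,n\}$, $n\ge 1$, whose morphisms are the order-preserving maps (resp. the maps preserving the linear betweenness relation, i.e. the maps that are order-preserving or order-reversing). For $\mathcal C\in\{\mathrm{OA},\mathrm{BA}\}$ let $\mathcal C\text{-Mod}$ be the category of functors from $\mathcal C$ to $k$-modules, and let $$\Psi_n=(1-d_1s_1)(1-d_2s_2)\cdots(1-d_{n-1}s_{n-1})\in k\mathcal C(n,n),\qquad \Psi_1=1,$$ where $d_i:[n-1]\to[n]$ is the increasing injection omitting $i$ and $s_i:[n]\to[n-1]$ is the non-decreasing surjection identifying $i$ and $i+1$; products are compositions, read from right to left. The elements $\Psi_n$ are idempotent. The normalized category $\mathscr K^{\mathcal C}$ is the $k$-linear category with objects the integers $n\ge 1$, morphisms $\mathscr K^{\mathcal C}(m,n)=\Psi_n\,k\mathcal C(m,n)\,\Psi_m$, composition that of $k\mathcal C$ and identities $\Psi_n$; $\mathscr K^{\mathcal C}\text{-Mod}$ is the category of $k$-linear functors from $\mathscr K^{\mathcal C}$ to $k$-modules. Let $C_2$ be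 the group with two elements. (1) $\mathrm{BA}\text{-Mod}$ is equivalent, as a $k$-linear category, to the category of complexes $(V_n,\mathbf d_n)_{n\ge1}$ in which $V_1$ is a $k$-module, regarded as a $kC_2$-module with trivial action, $V_n$ is a $kC_2$-module for $n\ge2$, and the differentials $\mathbf d_n:V_n\to V_{n+1}$, $n\ge1$, are $kC_2$-linear with $\mathbf d_{n+1}\mathbf d_n=0$. (Morphisms are the families of $kC_2$-linear maps commuting with the differentials.) (2) Suppose that $2$ is invertible in $k$ (for a field: $\operatorname{char}k\ne2$). Then there is an equivalence of $k$-linear categories $$\mathscr K^{\mathrm{BA}}\text{-Mod}\;\simeq\;\mathscr K_+\text{-Mod}\times\mathscr K_-\text{-Mod},$$ where $\mathscr K_+=\mathscr K^{\mathrm{OA}}$ is the normalized category of $\mathrm{OA}$ and $\mathscr K_-$ is its full subcategory on the objects $n\ge2$. The category $\mathrm{BA}\text{-Mod}$ is likewise equivalent, as a $k$-linear category, to this product. -/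

import Mathlib

open CategoryTheory CategoryTheory.Idempotents Simplicial

universe u v

noncomputable section

namespace DoldKanBA

/-! ### The categories of finite ordered sets and of finite betweenness structures

`SimplexCategory` plays the role of the category of the finite nonempty linearly ordered sets
`[1], [2], [3], …` and order-preserving maps; its object `⦋n⦌` has `n + 1` elements. -/

/-- The category of finite nonempty sets `{0 < 1 < ⋯ < len}` with their linear betweenness
relation; the object `⟨n⟩` has `n + 1` elements. -/
structure BA : Type where
  /-- one less than the number of elements -/
  len : ℕ

namespace BA

/-- A map of `BA` preserves betweenness: whenever `y` lies (weakly) between `x` and `z`, the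
point `f y` lies (weakly) between `f x` and `f z`. -/
@[ext]
structure Hom (a b : BA) : Type where
  /-- the underlying map -/
  toFun : Fin (a.len + 1) → Fin (b.len + 1)
  /-- preservation of the betweenness relation -/
  between : ∀ x z y, y ∈ Set.uIcc x z → toFun y ∈ Set.uIcc (toFun x) (toFun z)

instance : Category BA where
  Hom a b := Hom a b
  id _ := ⟨_root_.id, fun _ _ _ h => h⟩
  comp f g := ⟨g.toFun ∘ f.toFun, fun x z y h => g.between _ _ _ (f.between x z y h)⟩

/-- The betweenness-preserving maps are exactly the order-preserving or order-reversing maps. -/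
theorem between_iff {m n : ℕ} (f : Fin (m + 1) → Fin (n + 1)) :
    (∀ x z y, y ∈ Set.uIcc x z → f y ∈ Set.uIcc (f x) (f z)) ↔ Monotone f ∨ Antitone f :=
  Set.monotone_or_antitone_iff_uIcc.symm

end BA

/-- The simplex category as a wide subcategory of `BA`. -/
def simplexToBA : SimplexCategory ⥤ BA where
  obj a := ⟨a.len⟩
  map f := ⟨f.toOrderHom, (BA.between_iff _).2 (Or.inl f.toOrderHom.monotone)⟩

/-! ### The normalization idempotent -/

section Normalizer

variable {A : Type*} [Category* A] [Preadditive A] (X : CosimplicialObject A)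

/-- The endomorphism `1 - dᵢ sᵢ`, where `dᵢ` omits `i` and `sᵢ` identifies `i` and `i + 1`. -/
def normalizerStep {n : ℕ} (i : Fin (n + 1)) : X.obj ⦋n + 1⦌ ⟶ X.obj ⦋n + 1⦌ :=
  𝟙 _ - X.σ i ≫ X.δ i.castSucc

/-- The ordered product `(1 - d₀ s₀) ∘ (1 - d₁ s₁) ∘ ⋯ ∘ (1 - dⱼ₋₁ sⱼ₋₁)` on `X ⦋n + 1⦌`. -/
def normalizerAux {n : ℕ} (j : ℕ) (h : j ≤ n + 1) : X.obj ⦋n + 1⦌ ⟶ X.obj ⦋n + 1⦌ :=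
  match j, h with
  | 0, _ => 𝟙 _
  | j + 1, h => normalizerStep X ⟨j, h⟩ ≫ normalizerAux j (Nat.le_of_succ_le h)

/-- The normalization operator: the identity in degree `0` and the ordered product
`(1 - d₀ s₀) ∘ (1 - d₁ s₁) ∘ ⋯ ∘ (1 - dₙ sₙ)` in degree `n + 1`. -/
def normalizer (n : ℕ) : X.obj ⦋n⦌ ⟶ X.obj ⦋n⦌ :=
  match n with
  | 0 => 𝟙 _
  | n + 1 => normalizerAux X (n + 1) le_rfl

theorem normalizerStep_comp_σ_self {n : ℕ} (i : Fin (n + 1)) :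
    normalizerStep X i ≫ X.σ i = 0 := by
  simp [normalizerStep, CosimplicialObject.δ_comp_σ_self]

theorem normalizerStep_comp_σ_of_lt {n : ℕ} (i l : Fin (n + 1)) (h : i < l) :
    ∃ q, normalizerStep X i ≫ X.σ l = X.σ l ≫ q := by
  cases n with
  | zero => omega
  | succ n =>
    obtain ⟨a, rfl⟩ : ∃ a : Fin (n + 1), i = a.castSucc :=
      ⟨i.castPred (Fin.ne_last_of_lt h), by simp⟩
    obtain ⟨b, rfl⟩ : ∃ b : Fin (n + 1), l = b.succ :=
      ⟨l.pred (Fin.ne_zero_of_lt h), by simp⟩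
    have hab : a ≤ b := by
      simp only [Fin.lt_def, Fin.val_castSucc, Fin.val_succ] at h
      exact Fin.le_def.2 (by omega)
    refine ⟨𝟙 _ - X.σ a ≫ X.δ a.castSucc, ?_⟩
    have h1 := X.δ_comp_σ_of_le (i := a.castSucc) (j := b) (Fin.castSucc_le_castSucc_iff.2 hab)
    have h2 := X.σ_comp_σ hab
    simp only [normalizerStep, Preadditive.sub_comp, Preadditive.comp_sub, Category.id_comp,
      Category.comp_id, Category.assoc, h1]
    rw [← Category.assoc, h2, Category.assoc]

theorem normalizerAux_comp_σ_of_le {n : ℕ} (j : ℕ) (h : j ≤ n + 1) (l : Fin (n + 1))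
    (hl : j ≤ l) : ∃ q, normalizerAux X j h ≫ X.σ l = X.σ l ≫ q := by
  induction j with
  | zero => exact ⟨𝟙 _, by simp [normalizerAux]⟩
  | succ j ih =>
    obtain ⟨q, hq⟩ := ih (Nat.le_of_succ_le h) (by omega)
    obtain ⟨q', hq'⟩ := normalizerStep_comp_σ_of_lt X ⟨j, h⟩ l (Fin.lt_def.2 hl)
    refine ⟨q' ≫ q, ?_⟩
    simp only [normalizerAux, Category.assoc]
    rw [hq, ← Category.assoc, hq', Category.assoc]

theorem normalizerAux_comp_σ {n : ℕ} (j : ℕ) (h : j ≤ n + 1) (l : Fin (n + 1))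
    (hl : (l : ℕ) < j) : normalizerAux X j h ≫ X.σ l = 0 := by
  induction j with
  | zero => omega
  | succ j ih =>
    simp only [normalizerAux, Category.assoc]
    by_cases hlj : (l : ℕ) < j
    · rw [ih _ hlj, Limits.comp_zero]
    · obtain rfl : l = ⟨j, h⟩ := Fin.ext (by simp; omega)
      obtain ⟨q, hq⟩ := normalizerAux_comp_σ_of_le X j (Nat.le_of_succ_le h) ⟨j, h⟩ le_rfl
      rw [hq, ← Category.assoc, normalizerStep_comp_σ_self, Limits.zero_comp]

theorem comp_normalizerAux {n : ℕ} {Y : A} (f : Y ⟶ X.obj ⦋n + 1⦌)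
    (hf : ∀ i : Fin (n + 1), f ≫ X.σ i = 0) (j : ℕ) (h : j ≤ n + 1) :
    f ≫ normalizerAux X j h = f := by
  induction j with
  | zero => simp [normalizerAux]
  | succ j ih =>
    have : f ≫ normalizerStep X ⟨j, h⟩ = f := by
      rw [normalizerStep, Preadditive.comp_sub, ← Category.assoc, hf]
      simp
    rw [normalizerAux, ← Category.assoc, this, ih]

theorem normalizer_idem (n : ℕ) : normalizer X n ≫ normalizer X n = normalizer X n := by
  cases n with
  | zero => simp [normalizer]
  | succ n => exact comp_normalizerAux X _ (fun i => normalizerAux_comp_σ X _ _ i i.2) _ _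

end Normalizer

/-! ### Linear structures on Karoubi envelopes and products -/

section LinearInstances

variable (k : Type*) [CommRing k]

instance karoubiModule {A : Type*} [Category* A] [Preadditive A] [Linear k A] (P Q : Karoubi A) :
    Module k (P ⟶ Q) where
  smul r f := ⟨r • f.f, by rw [Linear.smul_comp, Linear.comp_smul, f.comm]⟩
  one_smul f := Karoubi.hom_ext _ _ (one_smul k f.f)
  mul_smul r s f := Karoubi.hom_ext _ _ (mul_smul r s f.f)
  smul_zero r := Karoubi.hom_ext _ _ (smul_zero r)
  smul_add r f g := Karoubi.hom_ext _ _ (smul_add r f.f g.f)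
  add_smul r s f := Karoubi.hom_ext _ _ (add_smul r s f.f)
  zero_smul f := Karoubi.hom_ext _ _ (zero_smul k f.f)

instance karoubiLinear {A : Type*} [Category* A] [Preadditive A] [Linear k A] :
    Linear k (Karoubi A) where
  homModule P Q := karoubiModule k P Q
  smul_comp _ _ _ r f g := Karoubi.hom_ext _ _ (Linear.smul_comp _ _ _ r f.f g.f)
  comp_smul _ _ _ f r g := Karoubi.hom_ext _ _ (Linear.comp_smul _ _ _ f.f r g.f)

instance prodPreadditive {A B : Type*} [Category* A] [Category* B] [Preadditive A]
    [Preadditive B] : Preadditive (A × B) where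
  homGroup X Y := inferInstanceAs (AddCommGroup ((X.1 ⟶ Y.1) × (X.2 ⟶ Y.2)))
  add_comp _ _ _ f f' g := Prod.ext (Preadditive.add_comp _ _ _ f.1 f'.1 g.1)
    (Preadditive.add_comp _ _ _ f.2 f'.2 g.2)
  comp_add _ _ _ f g g' := Prod.ext (Preadditive.comp_add _ _ _ f.1 g.1 g'.1)
    (Preadditive.comp_add _ _ _ f.2 g.2 g'.2)

instance prodLinear {A B : Type*} [Category* A] [Category* B] [Preadditive A]
    [Preadditive B] [Linear k A] [Linear k B] : Linear k (A × B) where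
  homModule X Y := inferInstanceAs (Module k ((X.1 ⟶ Y.1) × (X.2 ⟶ Y.2)))
  smul_comp _ _ _ r f g := Prod.ext (Linear.smul_comp _ _ _ r f.1 g.1)
    (Linear.smul_comp _ _ _ r f.2 g.2)
  comp_smul _ _ _ f r g := Prod.ext (Linear.comp_smul _ _ _ f.1 r g.1)
    (Linear.comp_smul _ _ _ f.2 r g.2)

end LinearInstances

/-! ### Normalized categories and their modules -/

section Normalized

variable (k : Type u) [CommRing k] {C : Type} [Category.{0} C] (ι : SimplexCategory ⥤ C)

/-- The `k`-linearization of `ι`, a cosimplicial object of the `k`-linear category `k C`. -/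
def linearized : CosimplicialObject (Free k C) := ι ⋙ Free.embedding k C

/-- The normalized category of `C`: its objects are the natural numbers `n`, standing for the
object `ι ⦋n⦌` with `n + 1` elements, and its morphisms `m ⟶ n` are the elements of
`Ψₙ · k C(ι ⦋m⦌, ι ⦋n⦌) · Ψₘ`, that is, the `k`-linear combinations `f` of morphisms of `C`
with `Ψₙ ∘ f ∘ Ψₘ = f`. The identity of `n` is the normalization idempotent `Ψₙ`. -/
abbrev Normalized : Type :=
  InducedCategory (Karoubi (Free k C)) fun n : ℕ =>
    { X := (linearized k ι).obj ⦋n⦌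
      p := normalizer (linearized k ι) n
      idem := normalizer_idem (linearized k ι) n }

/-- The full subcategory of the normalized category on all objects but the first one. -/
abbrev NormalizedPos : Type :=
  ObjectProperty.FullSubcategory (C := Normalized k ι) fun n : ℕ => n ≠ 0

end Normalized

/-- Modules over a `k`-linear category `K`: the `k`-linear functors from `K` to `k`-modules. -/
abbrev LinearModules (k : Type u) [CommRing k] (K : Type*) [Category* K] [Preadditive K]
    [Linear k K] : Type _ :=
  ObjectProperty.FullSubcategory fun F : K ⥤ ModuleCat.{v} k => F.Additive ∧ F.Linear k

/-- The group `C₂` with two elements. -/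
abbrev C₂ : Type := Multiplicative (ZMod 2)

/-- Complexes `V₀ ⟶ V₁ ⟶ V₂ ⟶ ⋯` of `k C₂`-modules and `k C₂`-linear differentials (of square
zero) such that `C₂` acts trivially on the first term, so that `V₀` is just a `k`-module. -/
abbrev TwofoldComplexes (k : Type u) [CommRing k] : Type _ :=
  ObjectProperty.FullSubcategory fun V : CochainComplex (Rep.{v} k C₂) ℕ =>
    (V.X 0).ρ.IsTrivial

/-- `k`-linear categories that are equivalent through a `k`-linear functor. -/
def LinearlyEquivalent (k : Type u) [CommRing k] (A B : Type*) [Category* A] [Category* B]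
    [Preadditive A] [Preadditive B] [Linear k A] [Linear k B] : Prop :=
  ∃ e : A ≌ B, e.functor.Additive ∧ e.functor.Linear k

end DoldKanBA

end

/-!
The theorem is a Dold–Kan correspondence for cosimplicial modules in which the order of the simplices
may be reversed.

Passing from `BA` to its normalized category does not change the modules. Indeed modules over a
category are linear modules over its linearization, and linear modules do not change when one passes
to another category with the same direct summands of finite direct sums
(`linearlyEquivalent_of_cover`). The identity of `⦋n + 1⦌` is the sum of `Ψ` and of maps which
factor through `⦋n⦌` (`normalizerAux_add_sum`), so every object is a direct summand of a finite
direct sum of objects of the normalized category (`linearlyEquivalent_normalized`).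

The normalized category is small. In `Ψₙ · f · Ψₘ`, the operator `Ψₘ` kills the maps `f` that
identify two neighbours, and `Ψₙ` kills those that miss a value other than the last one. The
remaining maps are the identity, the reversal, and their composites with the last coface map. Hence
the morphisms are spanned by the identities, the reversals `T` of `⦋n⦌` with the sign
`(-1) ^ (n (n + 1) / 2)`, the alternating sums `∂` of the coface maps, and the products of `T` and
`∂` (`SignedReversal.mem_span_isBasic`). They satisfy `T ^ 2 = 1`, `∂ ^ 2 = 0` and `T ∂ = ∂ T`, and
`T = 1` on `⦋0⦌`. So a module over the normalized category gives a complex of representations of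
`C₂`, with trivial action on the first term, and maps of modules are the same as maps of complexes.

That there are no further relations amounts to every such complex coming from a module. The module
is given by an explicit action of all betweenness-preserving maps on the complex (`basisAction`):
the identity acts as the identity, the reversal as the generator of `C₂` up to sign, the first coface
map, which has sign `+1` in `∂`, as the differential, the reversal followed by this coface map as
the corresponding composite, and every other map as zero. Maps that identify two neighbours act as
zero, so `Ψₘ · f` and `f` have the same effect (`linAction_normalizer_comp`), where `Ψₘ` is applied
before `f`. Therefore the values on `1`, `T`, `∂` and `T ∂` are the expected ones, and the action is
functorial on the normalized category (`nAction_comp`).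

The same spanning set, with `T = 1`, and restriction along the inclusion of the order-preserving
maps show that modules over the normalized category of ordered sets are complexes of `k`-modules;
without the first object, they are complexes without the first term. If `2` is invertible, a
complex of representations of `C₂` splits into its eigenspaces for `1` and `-1`. The action on the
first term being trivial, the second eigenspace is zero there, and the second complex may be any
complex that starts one degree later (`linearlyEquivalent_split`).
-/


noncomputable section

namespace DoldKanBA

/-! ### Linear equivalences of linear categories -/

section LinearlyEquivalent

variable {k : Type u} [CommRing k] {A B C : Type*} [Category* A] [Category* B] [Category* C]
  [Preadditive A] [Preadditive B] [Preadditive C] [Linear k A] [Linear k B] [Linear k C]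

theorem LinearlyEquivalent.of_functor (F : A ⥤ B) [F.Additive] [F.Linear k] [F.Full] [F.Faithful]
    [F.EssSurj] : LinearlyEquivalent k A B :=
  have : F.IsEquivalence := {}
  ⟨F.asEquivalence, inferInstanceAs F.Additive, inferInstanceAs (F.Linear k)⟩

theorem LinearlyEquivalent.symm (h : LinearlyEquivalent k A B) : LinearlyEquivalent k B A := by
  obtain ⟨e, he, he'⟩ := h
  exact ⟨e.symm, e.inverse_additive, e.inverseLinear k⟩

theorem LinearlyEquivalent.trans (h : LinearlyEquivalent k A B) (h' : LinearlyEquivalent k B C) :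
    LinearlyEquivalent k A C := by
  obtain ⟨e, he, he'⟩ := h
  obtain ⟨f, hf, hf'⟩ := h'
  exact ⟨e.trans f, inferInstanceAs (e.functor ⋙ f.functor).Additive,
    inferInstanceAs ((e.functor ⋙ f.functor).Linear k)⟩

theorem LinearlyEquivalent.prod {A' B' : Type*} [Category* A'] [Category* B'] [Preadditive A']
    [Preadditive B'] [Linear k A'] [Linear k B'] (h : LinearlyEquivalent k A A')
    (h' : LinearlyEquivalent k B B') : LinearlyEquivalent k (A × B) (A' × B') := by
  obtain ⟨e, _, _⟩ := h
  obtain ⟨f, _, _⟩ := h'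
  exact ⟨e.prod f, ⟨Prod.ext e.functor.map_add f.functor.map_add⟩,
    ⟨fun _ _ => Prod.ext (e.functor.map_smul _ _) (f.functor.map_smul _ _)⟩⟩

end LinearlyEquivalent

/-! ### Modules over a free linear category -/

section Free

variable {k : Type u} [CommRing k] {C : Type} [Category.{0} C]

/-- The linear map on the morphisms of a free linear category that extends a given function on
the morphisms of the original category. -/
def freeHomLift {M : Type*} [AddCommGroup M] [Module k M] {X Y : C} (ℓ : (X ⟶ Y) → M) :
    ((Free.embedding k C).obj X ⟶ (Free.embedding k C).obj Y) →ₗ[k] M :=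
  Finsupp.linearCombination k ℓ

@[simp]
theorem freeHomLift_embedding {M : Type*} [AddCommGroup M] [Module k M] {X Y : C}
    (ℓ : (X ⟶ Y) → M) (f : X ⟶ Y) : freeHomLift ℓ ((Free.embedding k C).map f) = ℓ f :=
  (Finsupp.linearCombination_single k (1 : k) f).trans (one_smul _ _)

theorem free_hom_induction {X Y : C}
    {p : ((Free.embedding k C).obj X ⟶ (Free.embedding k C).obj Y) → Prop}
    (f : (Free.embedding k C).obj X ⟶ (Free.embedding k C).obj Y) (zero : p 0)
    (add : ∀ f g, p f → p g → p (f + g))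
    (smul : ∀ (r : k) (f : X ⟶ Y), p (r • (Free.embedding k C).map f)) : p f := by
  refine Finsupp.induction_linear (motive := p) f zero add fun a b => ?_
  exact (congrArg p (Finsupp.smul_single_one a b : b • Finsupp.single a (1 : k) = _)).mp (smul b a)

theorem free_hom_ext {M : Type*} [AddCommGroup M] [Module k M] {X Y : C}
    {f g : ((Free.embedding k C).obj X ⟶ (Free.embedding k C).obj Y) →ₗ[k] M}
    (h : ∀ a : X ⟶ Y, f ((Free.embedding k C).map a) = g ((Free.embedding k C).map a)) :
    f = g := by
  apply LinearMap.ext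
  intro x
  induction x using free_hom_induction with
  | zero => rw [map_zero, map_zero]
  | add a b ha hb => rw [map_add, map_add, ha, hb]
  | smul r a => rw [map_smul, map_smul, h]

theorem freeHomLift_comp {D : Type*} [Category* D] [Preadditive D] [Linear k D] (F : C ⥤ D)
    {X Y Z : C} (f : (Free.embedding k C).obj X ⟶ (Free.embedding k C).obj Y)
    (g : (Free.embedding k C).obj Y ⟶ (Free.embedding k C).obj Z) :
    freeHomLift (fun a => F.map a) (f ≫ g) =
      freeHomLift (fun a => F.map a) f ≫ freeHomLift (fun a => F.map a) g := by
  induction f using free_hom_induction with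
  | zero => rw [Limits.zero_comp, map_zero, map_zero, Limits.zero_comp]
  | add a b ha hb => rw [Preadditive.add_comp, map_add, ha, hb, map_add, Preadditive.add_comp]
  | smul r a =>
    induction g using free_hom_induction with
    | zero => rw [Limits.comp_zero, map_zero, map_zero, Limits.comp_zero]
    | add b c hb hc =>
      rw [Preadditive.comp_add, map_add, hb, hc, map_add, Preadditive.comp_add]
    | smul s b =>
      rw [Linear.smul_comp, Linear.comp_smul, ← Functor.map_comp]
      simp only [map_smul, freeHomLift_embedding, Linear.smul_comp, Linear.comp_smul]
      rw [F.map_comp, smul_comm]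

theorem free_naturality {D : Type*} [Category* D] [Preadditive D] [Linear k D]
    (F G : Free k C ⥤ D) [F.Additive] [F.Linear k] [G.Additive] [G.Linear k]
    (η : Free.embedding k C ⋙ F ⟶ Free.embedding k C ⋙ G) {X Y : C}
    (f : (Free.embedding k C).obj X ⟶ (Free.embedding k C).obj Y) :
    F.map f ≫ η.app Y = η.app X ≫ G.map f := by
  induction f using free_hom_induction with
  | zero =>
    rw [Functor.map_zero, Functor.map_zero]
    exact Limits.zero_comp.trans Limits.comp_zero.symm
  | add a b ha hb =>
    rw [Functor.map_add, Functor.map_add]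
    exact (Preadditive.add_comp _ _ _ _ _ _).trans
      ((congrArg₂ (· + ·) ha hb).trans (Preadditive.comp_add _ _ _ _ _ _).symm)
  | smul r a =>
    rw [Functor.map_smul, Functor.map_smul]
    exact (Linear.smul_comp _ _ _ _ _ _).trans
      ((congrArg (r • ·) (η.naturality a)).trans (Linear.comp_smul _ _ _ _ _ _).symm)

/-- The linear functor on a free linear category extending a functor on the original category. -/
def freeFunctor {D : Type*} [Category* D] [Preadditive D] [Linear k D] (F : C ⥤ D) :
    Free k C ⥤ D where
  obj X := F.obj X
  map {X Y} f := freeHomLift (k := k) (C := C) (X := X) (Y := Y) (fun a => F.map a) f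
  map_id X := (freeHomLift_embedding (k := k) (C := C) (X := X) (Y := X) (fun a => F.map a)
    (𝟙 _)).trans (F.map_id X)
  map_comp {X Y Z} f g := freeHomLift_comp (k := k) (C := C) F (X := X) (Y := Y) (Z := Z) f g

@[simp]
theorem freeFunctor_map_embedding {D : Type*} [Category* D] [Preadditive D] [Linear k D]
    (F : C ⥤ D) {X Y : C} (f : X ⟶ Y) :
    (freeFunctor F).map ((Free.embedding k C).map f) = F.map f :=
  freeHomLift_embedding (k := k) (C := C) (X := X) (Y := Y) (fun a => F.map a) f

instance {D : Type*} [Category* D] [Preadditive D] [Linear k D] (F : C ⥤ D) :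
    (freeFunctor (k := k) F).Additive where
  map_add {X Y} _ _ := map_add
    (freeHomLift (k := k) (C := C) (X := X) (Y := Y) (fun a => F.map a)) _ _

instance {D : Type*} [Category* D] [Preadditive D] [Linear k D] (F : C ⥤ D) :
    (freeFunctor (k := k) F).Linear k where
  map_smul {X Y} _ _ := map_smul
    (freeHomLift (k := k) (C := C) (X := X) (Y := Y) (fun a => F.map a)) _ _

variable (k C)

/-- Restriction of modules along the embedding of a category into its linearization. -/
def restrictFree : LinearModules.{u, v} k (Free k C) ⥤ (C ⥤ ModuleCat.{v} k) :=
  ObjectProperty.ι _ ⋙ (Functor.whiskeringLeft _ _ _).obj (Free.embedding k C)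

instance : (restrictFree.{u, v} k C).Additive where
instance : (restrictFree.{u, v} k C).Linear k where

instance : (restrictFree.{u, v} k C).Faithful where
  map_injective {F G} f g h := by
    apply ObjectProperty.hom_ext
    ext1
    funext X
    exact NatTrans.congr_app h X

instance : (restrictFree.{u, v} k C).Full where
  map_surjective {F G} η := by
    have := F.property.1
    have := F.property.2
    have := G.property.1
    have := G.property.2
    exact ⟨ObjectProperty.homMk ⟨fun X => η.app X, fun X Y f =>
      free_naturality (k := k) (C := C) F.obj G.obj η (X := X) (Y := Y) f⟩, rfl⟩

instance : (restrictFree.{u, v} k C).EssSurj where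
  mem_essImage F := ⟨⟨freeFunctor F, inferInstance, inferInstance⟩,
    ⟨NatIso.ofComponents (fun X => Iso.refl _) fun {X Y} f => by
      refine (Category.comp_id _).trans (Eq.trans ?_ (Category.id_comp _).symm)
      exact freeFunctor_map_embedding F f⟩⟩

theorem linearlyEquivalent_free :
    LinearlyEquivalent k (C ⥤ ModuleCat.{v} k) (LinearModules.{u, v} k (Free k C)) :=
  (LinearlyEquivalent.of_functor (restrictFree.{u, v} k C)).symm

end Free

/-! ### Modules over a category covered by a full subcategory -/

section Cover

variable {k : Type u} [CommRing k] {K E : Type*} [Category* K] [Category* E]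
  [Preadditive K] [Preadditive E] [Linear k K] [Linear k E]

set_option linter.unusedSectionVars false

variable (k) in
/-- Restriction of modules along a linear functor. -/
def restrictModules (j : K ⥤ E) [j.Additive] [j.Linear k] :
    LinearModules.{u, v} k E ⥤ LinearModules.{u, v} k K :=
  ObjectProperty.lift _ (ObjectProperty.ι _ ⋙ (Functor.whiskeringLeft _ _ _).obj j) fun F => by
    have := F.property.1
    have := F.property.2
    exact ⟨inferInstanceAs (j ⋙ F.obj).Additive, inferInstanceAs ((j ⋙ F.obj).Linear k)⟩

/-- A cover of the object `e` by `j` exhibits `e` as a direct summand of a finite direct sum of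
objects in the image of `j`. -/
structure Cover (j : K ⥤ E) (e : E) where
  /-- the index set of the summands -/
  J : Type
  [fintype : Fintype J]
  /-- the summands -/
  obj : J → K
  /-- the components of the inclusion into the direct sum -/
  a : ∀ i, e ⟶ j.obj (obj i)
  /-- the components of the projection from the direct sum -/
  b : ∀ i, j.obj (obj i) ⟶ e
  sum_comp : ∑ i, a i ≫ b i = 𝟙 e

attribute [instance] Cover.fintype

/-- The objects in the image of `j` are covered by themselves. -/
def Cover.self (j : K ⥤ E) (m : K) : Cover j (j.obj m) where
  J := Unit
  obj _ := m
  a _ := 𝟙 _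
  b _ := 𝟙 _
  sum_comp := by simp

/-- A direct summand of a finite direct sum of covered objects is covered. -/
def Cover.glue {j : K ⥤ E} {e : E} {I : Type} [Fintype I] (x : I → E) (a : ∀ i, e ⟶ x i)
    (b : ∀ i, x i ⟶ e) (h : ∑ i, a i ≫ b i = 𝟙 e) (c : ∀ i, Cover j (x i)) : Cover j e where
  J := Σ i, (c i).J
  obj p := (c p.1).obj p.2
  a p := a p.1 ≫ (c p.1).a p.2
  b p := (c p.1).b p.2 ≫ b p.1
  sum_comp := by
    rw [← h, Fintype.sum_sigma]
    refine Finset.sum_congr rfl fun i _ => ?_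
    calc ∑ l, (a i ≫ (c i).a l) ≫ (c i).b l ≫ b i
        = a i ≫ (∑ l, (c i).a l ≫ (c i).b l) ≫ b i := by
          simp only [Preadditive.sum_comp, Preadditive.comp_sum, Category.assoc]
      _ = a i ≫ b i := by rw [(c i).sum_comp, Category.id_comp]

theorem restrictModules_faithful (j : K ⥤ E) [j.Additive] [j.Linear k] (c : ∀ e, Cover j e) :
    (restrictModules.{u, v} k j).Faithful where
  map_injective {F G} f g h := by
    have := F.property.1
    have hc : ∀ (m : K), f.hom.app (j.obj m) = g.hom.app (j.obj m) := fun m =>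
      NatTrans.congr_app (congrArg (fun t => t.hom) h) m
    apply ObjectProperty.hom_ext
    ext1
    funext e
    rw [← Category.id_comp (f.hom.app e), ← Category.id_comp (g.hom.app e), ← F.obj.map_id,
      ← (c e).sum_comp, Functor.map_sum, Preadditive.sum_comp, Preadditive.sum_comp]
    refine Finset.sum_congr rfl fun i _ => ?_
    rw [F.obj.map_comp, Category.assoc, Category.assoc, f.hom.naturality, g.hom.naturality, hc]

/-- A transformation between two additive functors that is defined on the objects in the image of
`j` extends along covers to all objects. -/
theorem exists_natTrans_of_cover {K E : Type*} [Category* K] [Category* E] [Preadditive E]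
    (j : K ⥤ E) {D : Type*} [Category* D] [Preadditive D] (F G : E ⥤ D)
    [F.Additive] [G.Additive] (c : ∀ e, Cover j e)
    (η : ∀ m, F.obj (j.obj m) ⟶ G.obj (j.obj m))
    (hη : ∀ {m n : K} (f : j.obj m ⟶ j.obj n), F.map f ≫ η n = η m ≫ G.map f) :
    ∃ φ : F ⟶ G, ∀ m, φ.app (j.obj m) = η m := by
  have hnat : ∀ {e e' : E} (f : e ⟶ e'),
      F.map f ≫ ∑ i, F.map ((c e').a i) ≫ η _ ≫ G.map ((c e').b i) =
        (∑ i, F.map ((c e).a i) ≫ η _ ≫ G.map ((c e).b i)) ≫ G.map f := by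
    intro e e' f
    have h1 : ∀ i, F.map f ≫ F.map ((c e').a i) ≫ η _ ≫ G.map ((c e').b i) =
        ∑ l, F.map ((c e).a l) ≫ η _ ≫ G.map ((c e).b l ≫ f ≫ (c e').a i ≫ (c e').b i) := by
      intro i
      calc _ = F.map ((∑ l, (c e).a l ≫ (c e).b l) ≫ f ≫ (c e').a i) ≫ η _ ≫
              G.map ((c e').b i) := by
            rw [(c e).sum_comp, Category.id_comp, F.map_comp, Category.assoc]
        _ = ∑ l, F.map ((c e).a l) ≫ (F.map ((c e).b l ≫ f ≫ (c e').a i) ≫ η _) ≫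
              G.map ((c e').b i) := by
            simp only [Preadditive.sum_comp, Functor.map_sum, Functor.map_comp, Category.assoc]
        _ = _ := by
            refine Finset.sum_congr rfl fun l _ => ?_
            rw [hη]
            simp only [Category.assoc, Functor.map_comp]
    rw [Preadditive.comp_sum, Finset.sum_congr rfl fun i _ => h1 i, Finset.sum_comm,
      Preadditive.sum_comp]
    refine Finset.sum_congr rfl fun l _ => ?_
    rw [← Preadditive.comp_sum, ← Preadditive.comp_sum, ← Functor.map_sum,
      ← Preadditive.comp_sum, ← Preadditive.comp_sum, (c e').sum_comp, Category.comp_id,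
      Functor.map_comp, Category.assoc, Category.assoc]
  refine ⟨⟨_, fun _ _ f => hnat f⟩, fun m => ?_⟩
  calc ∑ i, F.map ((c (j.obj m)).a i) ≫ η _ ≫ G.map ((c (j.obj m)).b i)
      = ∑ i, η m ≫ G.map ((c (j.obj m)).a i ≫ (c (j.obj m)).b i) :=
        Finset.sum_congr rfl fun i _ => by
          rw [← Category.assoc, hη, Category.assoc, Functor.map_comp]
    _ = η m := by
        rw [← Preadditive.comp_sum, ← Functor.map_sum, (c _).sum_comp, G.map_id,
          Category.comp_id]

theorem restrictModules_full (j : K ⥤ E) [j.Full] [j.Additive] [j.Linear k]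
    (c : ∀ e, Cover j e) : (restrictModules.{u, v} k j).Full where
  map_surjective {F G} η := by
    have := F.property.1
    have := G.property.1
    obtain ⟨φ, hφ⟩ := exists_natTrans_of_cover j F.obj G.obj c (fun m => η.hom.app m) fun f => by
      obtain ⟨f, rfl⟩ := j.map_surjective f
      exact η.hom.naturality f
    refine ⟨ObjectProperty.homMk φ, ?_⟩
    apply ObjectProperty.hom_ext
    ext1
    funext m
    exact hφ m

/-- A family of modules with maps that preserve compositions, but not necessarily identities,
gives a functor: the identities act as idempotents, and one restricts to their fixed points. -/
def fixedFunctor {E : Type*} [Category* E] (P : E → ModuleCat.{v} k)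
    (φ : ∀ {e e' : E}, (e ⟶ e') → (P e ⟶ P e'))
    (h : ∀ {e e' e'' : E} (f : e ⟶ e') (g : e' ⟶ e''), φ (f ≫ g) = φ f ≫ φ g) :
    E ⥤ ModuleCat.{v} k where
  obj e := ModuleCat.of k (LinearMap.eqLocus (φ (𝟙 e)).hom LinearMap.id)
  map {e e'} f := ModuleCat.ofHom ((φ f).hom.restrict fun x _ => by
    change (φ (𝟙 e')).hom ((φ f).hom x) = (φ f).hom x
    rw [← ModuleCat.comp_apply, ← h, Category.comp_id])
  map_id e := by
    ext x
    exact x.2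
  map_comp f g := by
    ext x
    change (φ (f ≫ g)).hom x.1 = (φ g).hom ((φ f).hom x.1)
    rw [h]
    rfl

variable (j : K ⥤ E) [j.Full] (M : K ⥤ ModuleCat.{v} k) (c : ∀ e, Cover j e)

/-- The matrix of a morphism `e ⟶ e'` with respect to covers of `e` and `e'`, evaluated in a
module `M`. -/
def coverMatrix {e e' : E} (f : e ⟶ e') :
    ModuleCat.of k (∀ i, M.obj ((c e).obj i)) ⟶ ModuleCat.of k (∀ i, M.obj ((c e').obj i)) :=
  ModuleCat.ofHom (LinearMap.pi fun i' => ∑ i,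
    (M.map (j.preimage ((c e).b i ≫ f ≫ (c e').a i'))).hom ∘ₗ LinearMap.proj i)

theorem coverMatrix_apply {e e' : E} (f : e ⟶ e') (x : ∀ i, M.obj ((c e).obj i)) (i' : (c e').J) :
    (coverMatrix j M c f).hom x i' =
      ∑ i, (M.map (j.preimage ((c e).b i ≫ f ≫ (c e').a i'))).hom (x i) := by
  simp [coverMatrix]

variable [j.Faithful] [j.Additive] [M.Additive]

theorem sum_map_preimage_comp {e : E} {m n : K} (f : j.obj m ⟶ e) (g : e ⟶ j.obj n)
    (x : M.obj m) : ∑ i, (M.map (j.preimage ((c e).b i ≫ g))).hom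
      ((M.map (j.preimage (f ≫ (c e).a i))).hom x) = (M.map (j.preimage (f ≫ g))).hom x := by
  have : j.preimage (f ≫ g) =
      ∑ i, j.preimage (f ≫ (c e).a i) ≫ j.preimage ((c e).b i ≫ g) := by
    apply j.map_injective
    rw [Functor.map_sum, Functor.map_preimage]
    calc f ≫ g = f ≫ (∑ i, (c e).a i ≫ (c e).b i) ≫ g := by
          rw [(c e).sum_comp, Category.id_comp]
      _ = _ := by
          simp only [Preadditive.sum_comp, Preadditive.comp_sum, Functor.map_comp,
            Functor.map_preimage, Category.assoc]
  rw [this, Functor.map_sum, ModuleCat.hom_sum, LinearMap.sum_apply]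
  simp only [Functor.map_comp, ModuleCat.hom_comp, LinearMap.comp_apply]

theorem coverMatrix_comp {e e' e'' : E} (f : e ⟶ e') (g : e' ⟶ e'') :
    coverMatrix j M c (f ≫ g) = coverMatrix j M c f ≫ coverMatrix j M c g := by
  ext x l
  change _ = (coverMatrix j M c g).hom ((coverMatrix j M c f).hom x) l
  rw [coverMatrix_apply, coverMatrix_apply]
  refine Eq.trans ?_ (Finset.sum_congr rfl fun i' _ =>
    congrArg _ (coverMatrix_apply j M c f x i')).symm
  simp only [map_sum]
  rw [Finset.sum_comm]
  refine Finset.sum_congr rfl fun i _ => ?_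
  have := sum_map_preimage_comp j M c ((c e).b i ≫ f) (g ≫ (c e'').a l) (x i)
  simp only [Category.assoc] at this ⊢
  exact this.symm

/-- The extension of a module along covers. -/
def coverExtension : E ⥤ ModuleCat.{v} k :=
  fixedFunctor (fun e => ModuleCat.of k (∀ i, M.obj ((c e).obj i))) (coverMatrix j M c)
    (coverMatrix_comp j M c)

theorem coverExtension_ext {e : E} {x y : (coverExtension j M c).obj e}
    (h : ∀ i, x.1 i = y.1 i) : x = y := Subtype.ext (funext h)

theorem coverExtension_prop {e : E} (x : (coverExtension j M c).obj e) (i' : (c e).J) :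
    ∑ i, (M.map (j.preimage ((c e).b i ≫ (c e).a i'))).hom (x.1 i) = x.1 i' := by
  have := congrFun (show (coverMatrix j M c (𝟙 e)).hom x.1 = x.1 from x.2) i'
  rw [coverMatrix_apply] at this
  simpa only [Category.id_comp] using this

theorem coverMatrix_add {e e' : E} (f g : e ⟶ e') :
    coverMatrix j M c (f + g) = coverMatrix j M c f + coverMatrix j M c g := by
  ext x i
  change _ = (coverMatrix j M c f).hom x i + (coverMatrix j M c g).hom x i
  rw [coverMatrix_apply, coverMatrix_apply, coverMatrix_apply, ← Finset.sum_add_distrib]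
  refine Finset.sum_congr rfl fun l _ => ?_
  have : j.preimage ((c e).b l ≫ (f + g) ≫ (c e').a i) =
      j.preimage ((c e).b l ≫ f ≫ (c e').a i) + j.preimage ((c e).b l ≫ g ≫ (c e').a i) := by
    apply j.map_injective
    simp
  rw [this, Functor.map_add]
  rfl

theorem coverMatrix_smul [j.Linear k] [M.Linear k] {e e' : E} (r : k) (f : e ⟶ e') :
    coverMatrix j M c (r • f) = r • coverMatrix j M c f := by
  ext x i
  change _ = r • (coverMatrix j M c f).hom x i
  rw [coverMatrix_apply, coverMatrix_apply, Finset.smul_sum]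
  refine Finset.sum_congr rfl fun l _ => ?_
  have : j.preimage ((c e).b l ≫ (r • f) ≫ (c e').a i) =
      r • j.preimage ((c e).b l ≫ f ≫ (c e').a i) := by
    apply j.map_injective
    rw [Functor.map_smul, Functor.map_preimage, Functor.map_preimage, Linear.smul_comp,
      Linear.comp_smul]
  rw [this, Functor.map_smul]
  rfl

instance : (coverExtension j M c).Additive where
  map_add {e e'} f g := by
    ext x
    exact Subtype.ext (congrArg (fun t => t.hom x.1) (coverMatrix_add j M c f g))

instance [j.Linear k] [M.Linear k] : (coverExtension j M c).Linear k where
  map_smul {e e'} f r := by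
    ext x
    exact Subtype.ext (congrArg (fun t => t.hom x.1) (coverMatrix_smul j M c r f))

/-- The value of the extension of `M` at an object in the image of `j` is the value of `M`. -/
def coverExtensionObjEquiv (m : K) : M.obj m ≃ₗ[k] (coverExtension j M c).obj (j.obj m) where
  toFun x := ⟨fun i => (M.map (j.preimage ((c (j.obj m)).a i))).hom x, by
    change (coverMatrix j M c (𝟙 (j.obj m))).hom _ = _
    funext l
    rw [coverMatrix_apply]
    have := sum_map_preimage_comp j M c (𝟙 _) ((c (j.obj m)).a l) x
    simp only [Category.id_comp] at this ⊢
    exact this⟩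
  map_add' x y := Subtype.ext (funext fun i => map_add _ _ _)
  map_smul' r x := Subtype.ext (funext fun i => map_smul _ _ _)
  invFun y := ∑ i, (M.map (j.preimage ((c (j.obj m)).b i))).hom (y.1 i)
  left_inv x := by
    have := sum_map_preimage_comp j M c (𝟙 (j.obj m)) (𝟙 _) x
    simp only [Category.id_comp, Category.comp_id, j.preimage_id, M.map_id] at this
    exact this
  right_inv y := by
    refine coverExtension_ext j M c fun l => ?_
    change (M.map _).hom (∑ i, (M.map (j.preimage ((c (j.obj m)).b i))).hom (y.1 i)) = _
    rw [map_sum]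
    refine Eq.trans (Finset.sum_congr rfl fun i _ => ?_) (coverExtension_prop j M c y l)
    rw [j.preimage_comp, M.map_comp]
    rfl

theorem restrictModules_essSurj [j.Linear k] (c : ∀ e, Cover j e) :
    (restrictModules.{u, v} k j).EssSurj where
  mem_essImage N := by
    obtain ⟨M, h1, h2⟩ := N
    refine ⟨⟨coverExtension j M c, inferInstance, inferInstance⟩,
      ⟨ObjectProperty.isoMk _ (NatIso.ofComponents
        (fun m => (coverExtensionObjEquiv j M c m).toModuleIso) fun {m n} f => ?_).symm⟩⟩
    ext x
    refine coverExtension_ext j M c fun i => ?_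
    change (M.map (j.preimage ((c (j.obj n)).a i))).hom ((M.map f).hom x) =
      (coverMatrix j M c (j.map f)).hom (fun i => (M.map (j.preimage ((c (j.obj m)).a i))).hom x) i
    rw [coverMatrix_apply]
    have := sum_map_preimage_comp j M c (𝟙 _) (j.map f ≫ (c (j.obj n)).a i) x
    simp only [Category.id_comp, j.preimage_comp, j.preimage_map, M.map_comp] at this ⊢
    exact this.symm

/-- If every object of `E` is a direct summand of a finite direct sum of objects of a full
subcategory `K`, then `E` and `K` have the same modules. -/
theorem linearlyEquivalent_of_cover [j.Linear k] (c : ∀ e, Nonempty (Cover j e)) :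
    LinearlyEquivalent k (LinearModules.{u, v} k E) (LinearModules.{u, v} k K) := by
  have c := fun e => (c e).some
  have := restrictModules_faithful.{u, v} (k := k) j c
  have := restrictModules_full.{u, v} (k := k) j c
  have := restrictModules_essSurj.{u, v} (k := k) j c
  have : (restrictModules.{u, v} k j).Additive := {}
  have : (restrictModules.{u, v} k j).Linear k := {}
  exact LinearlyEquivalent.of_functor (restrictModules.{u, v} k j)

end Cover

/-! ### Modules over the normalized category -/

section NormalizedCover

/-- The product of the `1 - dᵢ sᵢ` differs from the identity by a telescoping sum of maps which
factor through codegeneracies. -/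
theorem normalizerAux_add_sum {A : Type*} [Category* A] [Preadditive A] (X : CosimplicialObject A)
    {n : ℕ} (j : ℕ) (h : j ≤ n + 1) :
    normalizerAux X j h + ∑ i : Fin j, X.σ (Fin.castLE h i) ≫ X.δ (Fin.castLE h i).castSucc ≫
      normalizerAux X i (i.2.le.trans h) = 𝟙 _ := by
  induction j with
  | zero => simp [normalizerAux]
  | succ j ih =>
    rw [Fin.sum_univ_castSucc, normalizerAux, normalizerStep, Preadditive.sub_comp,
      Category.id_comp]
    refine Eq.trans ?_ (ih (Nat.le_of_succ_le h))
    simp only [Category.assoc]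
    change _ - X.σ ⟨j, h⟩ ≫ X.δ (⟨j, h⟩ : Fin (n + 1)).castSucc ≫ _ + (_ + X.σ ⟨j, h⟩ ≫
      X.δ (⟨j, h⟩ : Fin (n + 1)).castSucc ≫ _) = _
    rw [add_comm (Finset.sum _ _), ← add_assoc]
    exact congrArg (· + _) (sub_add_cancel _ _)

variable (k : Type u) [CommRing k] {C : Type} [Category.{0} C] (ι : SimplexCategory ⥤ C)

/-- The inclusion of the normalized category into the Karoubi envelope. -/
abbrev normalizedInclusion : Normalized k ι ⥤ Karoubi (Free k C) := inducedFunctor _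

/-- The identity of `ι ⦋n⦌` is the sum of the normalization idempotent `Ψₙ` and of maps which
factor through `ι ⦋n - 1⦌`; hence, inductively, `ι ⦋n⦌` is a direct summand of a finite direct sum
of the objects `0, …, n` of the normalized category. -/
theorem nonempty_cover_linearized (n : ℕ) : Nonempty (Cover (normalizedInclusion k ι)
    ((toKaroubi (Free k C)).obj ((linearized k ι).obj ⦋n⦌))) := by
  induction n with
  | zero =>
    exact ⟨Cover.self (normalizedInclusion k ι) (0 : ℕ)⟩
  | succ n ih =>
    obtain ⟨c⟩ := ih
    let X := linearized k ι
    let P := (normalizedInclusion k ι).obj (n + 1 : ℕ)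
    let T := toKaroubi (Free k C)
    have hP : P.p = normalizerAux X (n + 1) le_rfl := rfl
    let a : T.obj (X.obj ⦋n + 1⦌) ⟶ P := ⟨P.p, by
      change 𝟙 _ ≫ P.p ≫ P.p = P.p
      rw [P.idem, Category.id_comp]⟩
    let b : P ⟶ T.obj (X.obj ⦋n + 1⦌) := ⟨P.p, by
      change P.p ≫ P.p ≫ 𝟙 _ = P.p
      rw [Category.comp_id, P.idem]⟩
    refine ⟨Cover.glue (I := Option (Fin (n + 1)))
      (fun i => i.elim P (fun _ => T.obj (X.obj ⦋n⦌)))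
      (fun i => match i with
        | none => a
        | some i => T.map (X.σ i))
      (fun i => match i with
        | none => b
        | some i => T.map (X.δ i.castSucc ≫ normalizerAux X i i.2.le)) ?_
      (fun i => match i with
        | none => Cover.self (normalizedInclusion k ι) (n + 1 : ℕ)
        | some _ => c)⟩
    rw [Fintype.sum_option]
    have h1 : a ≫ b = T.map (normalizerAux X (n + 1) le_rfl) := by
      apply Karoubi.hom_ext
      exact P.idem
    change a ≫ b + ∑ i : Fin (n + 1), T.map (X.σ i) ≫
      T.map (X.δ i.castSucc ≫ normalizerAux X i i.2.le) = _
    simp only [h1, ← T.map_comp]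
    rw [← Functor.map_sum, ← Functor.map_add, ← T.map_id]
    exact congrArg T.map (normalizerAux_add_sum X (n + 1) le_rfl)

variable [ι.EssSurj]

theorem nonempty_cover_normalized (P : Karoubi (Free k C)) :
    Nonempty (Cover (normalizedInclusion k ι) P) := by
  let T := toKaroubi (Free k C)
  obtain ⟨c⟩ := nonempty_cover_linearized k ι (ι.objPreimage P.X).len
  let e : (linearized k ι).obj ⦋(ι.objPreimage P.X).len⦌ ≅ P.X :=
    (Free.embedding k C).mapIso (ι.objObjPreimageIso P.X)
  refine ⟨Cover.glue (I := Unit) (fun _ => T.obj ((linearized k ι).obj ⦋_⦌))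
    (fun _ => ⟨P.p ≫ e.inv, ?_⟩) (fun _ => ⟨e.hom ≫ P.p, ?_⟩) ?_ (fun _ => c)⟩
  · change P.p ≫ (P.p ≫ e.inv) ≫ 𝟙 _ = _
    rw [Category.comp_id, ← Category.assoc, P.idem]
  · change 𝟙 _ ≫ (e.hom ≫ P.p) ≫ P.p = _
    rw [Category.id_comp, Category.assoc, P.idem]
  · rw [Fintype.sum_unique]
    apply Karoubi.hom_ext
    change (P.p ≫ e.inv) ≫ e.hom ≫ P.p = P.p
    rw [Category.assoc, e.inv_hom_id_assoc, P.idem]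

theorem nonempty_cover_toKaroubi (P : Karoubi (Free k C)) :
    Nonempty (Cover (toKaroubi (Free k C)) P) := by
  let T := toKaroubi (Free k C)
  refine ⟨Cover.glue (I := Unit) (fun _ => T.obj P.X)
    (fun _ => ⟨P.p, ?_⟩) (fun _ => ⟨P.p, ?_⟩) ?_ (fun _ => Cover.self T P.X)⟩
  · change P.p ≫ P.p ≫ 𝟙 _ = _
    rw [Category.comp_id, P.idem]
  · change 𝟙 _ ≫ P.p ≫ P.p = _
    rw [Category.id_comp, P.idem]
  · rw [Fintype.sum_unique]
    apply Karoubi.hom_ext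
    exact P.idem

/-- The modules over `C` are the modules over the normalized category of `C`. -/
theorem linearlyEquivalent_normalized :
    LinearlyEquivalent k (C ⥤ ModuleCat.{v} k) (LinearModules.{u, v} k (Normalized k ι)) := by
  have : (toKaroubi (Free k C)).Linear k := { map_smul := fun _ _ => rfl }
  have : (normalizedInclusion k ι).Additive := { map_add := rfl }
  have : (normalizedInclusion k ι).Linear k := { map_smul := fun _ _ => rfl }
  exact (linearlyEquivalent_free k C).trans
    ((linearlyEquivalent_of_cover _ (nonempty_cover_toKaroubi k)).symm.trans
      (linearlyEquivalent_of_cover (normalizedInclusion k ι) (nonempty_cover_normalized k ι)))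

end NormalizedCover

/-! ### Generators of the normalized category -/

section NormalizerIdentities

variable {A : Type*} [Category* A] [Preadditive A] (X : CosimplicialObject A)

theorem normalizer_comp_σ {n : ℕ} (i : Fin (n + 1)) : normalizer X (n + 1) ≫ X.σ i = 0 :=
  normalizerAux_comp_σ X _ _ i i.2

theorem δ_comp_normalizerStep_of_lt {n : ℕ} (i j : Fin (n + 1)) (h : i < j) :
    ∃ q, X.δ i.castSucc ≫ normalizerStep X j = q ≫ X.δ i.castSucc := by
  cases n with
  | zero => omega
  | succ n =>
    obtain ⟨a, rfl⟩ : ∃ a : Fin (n + 1), i = a.castSucc :=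
      ⟨i.castPred (Fin.ne_last_of_lt h), by simp⟩
    obtain ⟨b, rfl⟩ : ∃ b : Fin (n + 1), j = b.succ :=
      ⟨j.pred (Fin.ne_zero_of_lt h), by simp⟩
    have hab : a ≤ b := by
      simp only [Fin.lt_def, Fin.val_castSucc, Fin.val_succ] at h
      exact Fin.le_def.2 (by omega)
    refine ⟨𝟙 _ - X.σ b ≫ X.δ b.castSucc, ?_⟩
    have h1 := X.δ_comp_σ_of_le (i := a.castSucc) (j := b) (Fin.castSucc_le_castSucc_iff.2 hab)
    have h2 := X.δ_comp_δ (i := a.castSucc) (j := b.castSucc) (Fin.castSucc_le_castSucc_iff.2 hab)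
    simp only [normalizerStep, Preadditive.sub_comp, Preadditive.comp_sub, Category.id_comp,
      Category.comp_id, Category.assoc, ← h2]
    rw [← Category.assoc, h1, Category.assoc]
    rfl

/-- `Ψₙ` vanishes on the images of all the coface maps but the last one. -/
theorem δ_comp_normalizer {n : ℕ} (i : Fin (n + 1)) :
    X.δ i.castSucc ≫ normalizer X (n + 1) = 0 := by
  suffices h : ∀ (j : ℕ) (h : j ≤ n + 1), (i : ℕ) < j → X.δ i.castSucc ≫ normalizerAux X j h = 0 from
    h _ le_rfl i.2
  intro j h hij
  induction j with
  | zero => omega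
  | succ j ih =>
    rw [normalizerAux, ← Category.assoc]
    by_cases hj : (i : ℕ) < j
    · obtain ⟨q, hq⟩ := δ_comp_normalizerStep_of_lt X i ⟨j, h⟩ (Fin.lt_def.2 hj)
      rw [hq, Category.assoc, ih _ hj, Limits.comp_zero]
    · obtain rfl : i = ⟨j, h⟩ := Fin.ext (by simp; omega)
      have : X.δ (Fin.castSucc ⟨j, h⟩) ≫ normalizerStep X ⟨j, h⟩ = 0 := by
        rw [normalizerStep, Preadditive.comp_sub, ← Category.assoc, X.δ_comp_σ_self]
        simp
      rw [this, Limits.zero_comp]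

open AlgebraicTopology.AlternatingCofaceMapComplex (objD)

theorem objD_comp_normalizer (n : ℕ) : objD X n ≫ normalizer X (n + 1) =
    (-1 : ℤ) ^ (n + 1) • X.δ (Fin.last (n + 1)) ≫ normalizer X (n + 1) := by
  rw [objD, Fin.sum_univ_castSucc, Preadditive.add_comp, Preadditive.sum_comp,
    Finset.sum_eq_zero fun i _ => ?_, zero_add, Preadditive.zsmul_comp]
  · rfl
  · rw [Preadditive.zsmul_comp, δ_comp_normalizer, smul_zero]

theorem normalizer_comp_δ_comp_σ {n : ℕ} (i : Fin (n + 2)) (j : Fin (n + 1))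
    (h : i ≠ j.castSucc) (h' : i ≠ j.succ) : normalizer X n ≫ X.δ i ≫ X.σ j = 0 := by
  cases n with
  | zero =>
    have h1 := Fin.val_ne_of_ne h
    have h2 := Fin.val_ne_of_ne h'
    simp only [Fin.val_castSucc, Fin.val_succ] at h1 h2
    omega
  | succ n =>
    rcases lt_or_gt_of_ne h with hij | hij
    · obtain ⟨a, rfl⟩ : ∃ a : Fin (n + 2), i = a.castSucc :=
        ⟨i.castPred (Fin.ne_last_of_lt hij), by simp⟩
      obtain ⟨b, rfl⟩ : ∃ b : Fin (n + 1), j = b.succ :=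
        ⟨j.pred (by rintro rfl; simp at hij), by simp⟩
      rw [X.δ_comp_σ_of_le (Fin.le_def.2 (by simp [Fin.lt_def] at hij ⊢; omega)),
        ← Category.assoc, normalizer_comp_σ, Limits.zero_comp]
    · have hij' : (j : ℕ) + 1 < i := by
        have := Fin.val_ne_of_ne h'
        simp only [Fin.lt_def, Fin.val_castSucc, Fin.val_succ] at this hij
        omega
      obtain ⟨a, rfl⟩ : ∃ a : Fin (n + 2), i = a.succ :=
        ⟨i.pred (by rintro rfl; simp at hij'), by simp⟩
      obtain ⟨b, rfl⟩ : ∃ b : Fin (n + 1), j = b.castSucc :=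
        ⟨j.castPred (by rintro rfl; simp at hij'; omega), by simp⟩
      rw [X.δ_comp_σ_of_gt (Fin.lt_def.2 (by simp at hij' ⊢; omega)),
        ← Category.assoc, normalizer_comp_σ, Limits.zero_comp]

theorem normalizer_comp_objD_comp_σ {n : ℕ} (j : Fin (n + 1)) :
    (normalizer X n ≫ objD X n) ≫ X.σ j = 0 := by
  rw [objD, Preadditive.comp_sum, Preadditive.sum_comp,
    Fintype.sum_eq_add j.castSucc j.succ (by simp [Fin.ext_iff])]
  · simp only [Preadditive.comp_zsmul, Preadditive.zsmul_comp, Category.assoc,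
      X.δ_comp_σ_self, X.δ_comp_σ_succ, Fin.val_castSucc, Fin.val_succ, pow_succ]
    simp
  · intro i hi
    rw [Preadditive.comp_zsmul, Preadditive.zsmul_comp, Category.assoc,
      normalizer_comp_δ_comp_σ X i j hi.1 hi.2, smul_zero]

theorem normalizer_comp_objD_comp_normalizer (n : ℕ) :
    (normalizer X n ≫ objD X n) ≫ normalizer X (n + 1) = normalizer X n ≫ objD X n :=
  comp_normalizerAux X _ (fun j => normalizer_comp_objD_comp_σ X j) _ _

end NormalizerIdentities

section Generators

open AlgebraicTopology.AlternatingCofaceMapComplex (objD d_squared)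

variable (k : Type u) [CommRing k] {C : Type} [Category.{0} C] (ι : SimplexCategory ⥤ C)

/-- The linear combinations of the morphisms `ι ⦋m⦌ ⟶ ι ⦋n⦌` of `C`. -/
abbrev LinHom (m n : ℕ) : Type u := (linearized k ι).obj ⦋m⦌ ⟶ (linearized k ι).obj ⦋n⦌

variable {k ι} in
/-- The linear combinations of morphisms `ι ⦋m⦌ ⟶ ι ⦋n⦌` that, given endomorphisms `t n` of the
objects `ι ⦋n⦌`, span all of them in the categories of interest. -/
inductive IsElementary (t : ∀ n, LinHom k ι n n) : ∀ {m n : ℕ}, LinHom k ι m n → Prop where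
  /-- the morphisms which factor through a codegeneracy -/
  | degenerate {m n : ℕ} (i : Fin (m + 1)) (φ : LinHom k ι m n) :
      IsElementary t ((linearized k ι).σ i ≫ φ)
  /-- the morphisms which factor through a coface map other than the last one -/
  | face {m n : ℕ} (i : Fin (n + 1)) (φ : LinHom k ι m n) :
      IsElementary t (φ ≫ (linearized k ι).δ i.castSucc)
  /-- the identities -/
  | id (n : ℕ) : IsElementary t (𝟙 ((linearized k ι).obj ⦋n⦌))
  /-- the given endomorphisms -/
  | reversal (n : ℕ) : IsElementary t (t n)
  /-- the last coface maps -/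
  | last (n : ℕ) : IsElementary t ((linearized k ι).δ (Fin.last (n + 1)))
  /-- the last coface maps, preceded by the given endomorphisms -/
  | reversal_last (n : ℕ) : IsElementary t (t n ≫ (linearized k ι).δ (Fin.last (n + 1)))

/-- A signed reversal: involutions `t n` of the objects `ι ⦋n⦌` of the linearization of `C` that
permute the codegeneracies up to isomorphism and commute with the alternating sum of the coface
maps, and for which the morphisms listed in `IsElementary` span all morphisms. -/
structure SignedReversal where
  /-- the involution of `ι ⦋n⦌` -/
  t : ∀ n, LinHom k ι n n
  t_comp_t : ∀ n, t n ≫ t n = 𝟙 _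
  t_comp_σ : ∀ {n} (i : Fin (n + 1)), ∃ (j : Fin (n + 1)) (q : LinHom k ι n n),
    t (n + 1) ≫ (linearized k ι).σ i = (linearized k ι).σ j ≫ q
  t_comp_objD : ∀ n, t n ≫ objD (linearized k ι) n = objD (linearized k ι) n ≫ t (n + 1)
  mem_span : ∀ {m n} (f : LinHom k ι m n), f ∈ Submodule.span k {g | IsElementary t g}

/-- The object `n` of the normalized category. -/
abbrev nObj (n : ℕ) : Normalized k ι := n

/-- The projection `f ↦ Ψₙ ∘ f ∘ Ψₘ` onto the morphisms of the normalized category. -/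
def normalize {m n : ℕ} : LinHom k ι m n →ₗ[k] (nObj k ι m ⟶ nObj k ι n) where
  toFun f := ⟨⟨normalizer (linearized k ι) m ≫ f ≫ normalizer (linearized k ι) n, by
    change normalizer (linearized k ι) m ≫ (normalizer (linearized k ι) m ≫ f ≫
      normalizer (linearized k ι) n) ≫ normalizer (linearized k ι) n = _
    simp only [Category.assoc, normalizer_idem]
    rw [← Category.assoc, normalizer_idem]⟩⟩
  map_add' f g := by
    apply InducedCategory.hom_ext
    apply Karoubi.hom_ext
    change _ = normalizer (linearized k ι) m ≫ f ≫ normalizer (linearized k ι) n +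
      normalizer (linearized k ι) m ≫ g ≫ normalizer (linearized k ι) n
    rw [← Preadditive.comp_add, ← Preadditive.add_comp]
  map_smul' r f := by
    apply InducedCategory.hom_ext
    apply Karoubi.hom_ext
    change _ = r • (normalizer (linearized k ι) m ≫ f ≫ normalizer (linearized k ι) n)
    rw [← Linear.comp_smul, ← Linear.smul_comp]

variable {k ι}

theorem normalize_hom_f {m n : ℕ} (f : LinHom k ι m n) : (normalize k ι f).hom.f =
    normalizer (linearized k ι) m ≫ f ≫ normalizer (linearized k ι) n := rfl

theorem normalized_hom_ext {m n : ℕ} {f g : nObj k ι m ⟶ nObj k ι n} (h : f.hom.f = g.hom.f) :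
    f = g := InducedCategory.hom_ext (Karoubi.hom_ext _ _ h)

theorem normalize_hom_self {m n : ℕ} (f : nObj k ι m ⟶ nObj k ι n) :
    normalize k ι (m := m) (n := n) f.hom.f = f :=
  normalized_hom_ext f.hom.comm

variable (k ι)

/-- The differential in the normalized category. -/
def nD (n : ℕ) : nObj k ι n ⟶ nObj k ι (n + 1) := normalize k ι (objD (linearized k ι) n)

theorem nD_hom_f (n : ℕ) : (nD k ι n).hom.f =
    normalizer (linearized k ι) n ≫ objD (linearized k ι) n := by
  refine Eq.trans ?_ (normalizer_comp_objD_comp_normalizer (linearized k ι) n)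
  exact (Category.assoc _ _ _).symm

theorem nD_comp_nD (n : ℕ) : nD k ι n ≫ nD k ι (n + 1) = 0 := by
  apply normalized_hom_ext
  change (nD k ι n).hom.f ≫ (normalizer (linearized k ι) (n + 1) ≫
    objD (linearized k ι) (n + 1) ≫ normalizer (linearized k ι) (n + 2)) = 0
  rw [nD_hom_f, ← Category.assoc, normalizer_comp_objD_comp_normalizer, Category.assoc,
    ← Category.assoc (objD _ _), d_squared, Limits.zero_comp, Limits.comp_zero]

theorem normalize_last (n : ℕ) : normalize k ι ((linearized k ι).δ (Fin.last (n + 1))) =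
    (-1 : ℤ) ^ (n + 1) • nD k ι n := by
  rw [nD, ← map_zsmul]
  apply normalized_hom_ext
  rw [normalize_hom_f, normalize_hom_f, Preadditive.zsmul_comp, objD_comp_normalizer, smul_smul,
    ← mul_pow]
  simp

variable {k ι} (R : SignedReversal k ι)

namespace SignedReversal

/-- The reversal in the normalized category. -/
def nT (n : ℕ) : nObj k ι n ⟶ nObj k ι n := normalize k ι (R.t n)

theorem normalizer_comp_t_comp_normalizer (n : ℕ) :
    (normalizer (linearized k ι) n ≫ R.t n) ≫ normalizer (linearized k ι) n =
      normalizer (linearized k ι) n ≫ R.t n := by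
  cases n with
  | zero => exact Category.comp_id _
  | succ n =>
    refine comp_normalizerAux _ _ (fun i => ?_) _ _
    obtain ⟨j, q, h⟩ := R.t_comp_σ i
    rw [Category.assoc, h, ← Category.assoc, normalizer_comp_σ, Limits.zero_comp]

theorem nT_hom_f (n : ℕ) : (R.nT n).hom.f = normalizer (linearized k ι) n ≫ R.t n := by
  refine Eq.trans ?_ (R.normalizer_comp_t_comp_normalizer n)
  exact (Category.assoc _ _ _).symm

theorem nT_comp_nT (n : ℕ) : R.nT n ≫ R.nT n = 𝟙 _ := by
  apply normalized_hom_ext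
  change (R.nT n).hom.f ≫ (R.nT n).hom.f = normalizer (linearized k ι) n
  rw [nT_hom_f, ← Category.assoc, normalizer_comp_t_comp_normalizer, Category.assoc, R.t_comp_t,
    Category.comp_id]

theorem nT_comp_normalize {m n : ℕ} (f : LinHom k ι m n) :
    R.nT m ≫ normalize k ι f = normalize k ι (R.t m ≫ f) := by
  apply normalized_hom_ext
  change (R.nT m).hom.f ≫ (normalize k ι f).hom.f = _
  rw [normalize_hom_f, nT_hom_f, ← Category.assoc, normalizer_comp_t_comp_normalizer,
    normalize_hom_f]
  simp only [Category.assoc]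

theorem nD_comp_nT (n : ℕ) : nD k ι n ≫ R.nT (n + 1) = R.nT n ≫ nD k ι n := by
  rw [nD, nT_comp_normalize, ← nD, R.t_comp_objD]
  apply normalized_hom_ext
  change (nD k ι n).hom.f ≫ (normalize k ι (R.t (n + 1))).hom.f = _
  rw [normalize_hom_f, nD_hom_f, ← Category.assoc, normalizer_comp_objD_comp_normalizer,
    normalize_hom_f]
  simp only [Category.assoc]

/-- The morphisms of the normalized category which span all of them. -/
inductive IsBasic : ∀ {m n : ℕ}, (nObj k ι m ⟶ nObj k ι n) → Prop where
  /-- the identities -/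
  | id (n : ℕ) : IsBasic (𝟙 (nObj k ι n))
  /-- the reversals -/
  | nT (n : ℕ) : IsBasic (R.nT n)
  /-- the differentials -/
  | nD (n : ℕ) : IsBasic (nD k ι n)
  /-- the differentials, preceded by the reversals -/
  | nT_nD (n : ℕ) : IsBasic (R.nT n ≫ DoldKanBA.nD k ι n)

theorem mem_span_isBasic {m n : ℕ} (f : nObj k ι m ⟶ nObj k ι n) :
    f ∈ Submodule.span k {g | R.IsBasic g} := by
  rw [← normalize_hom_self f]
  have := Submodule.apply_mem_span_image_of_mem_span (normalize k ι) (R.mem_span f.hom.f)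
  refine Submodule.span_le.2 ?_ this
  rintro _ ⟨g, hg, rfl⟩
  have h0 : ∀ {m n : ℕ} {g : LinHom k ι m n}, normalizer (linearized k ι) m ≫ g ≫
      normalizer (linearized k ι) n = 0 →
      normalize k ι g ∈ Submodule.span k {g | R.IsBasic g} := fun {m n g} h => by
    have : normalize k ι g = 0 := normalized_hom_ext h
    rw [this]
    exact zero_mem _
  cases hg with
  | degenerate i ψ =>
    apply h0
    rw [Category.assoc, ← Category.assoc, normalizer_comp_σ, Limits.zero_comp]
  | face i ψ =>
    apply h0
    rw [Category.assoc, δ_comp_normalizer, Limits.comp_zero, Limits.comp_zero]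
  | id n =>
    refine Submodule.subset_span ?_
    have : normalize k ι (𝟙 ((linearized k ι).obj ⦋m⦌)) = 𝟙 (nObj k ι m) := by
      apply normalized_hom_ext
      rw [normalize_hom_f, Category.id_comp, normalizer_idem]
      rfl
    rw [this]
    exact IsBasic.id _
  | reversal n => exact Submodule.subset_span (IsBasic.nT _)
  | last n =>
    rw [normalize_last]
    exact zsmul_mem (Submodule.subset_span (IsBasic.nD _)) _
  | reversal_last n =>
    rw [← nT_comp_normalize, normalize_last, Preadditive.comp_zsmul]
    exact zsmul_mem (Submodule.subset_span (IsBasic.nT_nD _)) _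

end SignedReversal

end Generators

/-! ### Monotone and antitone maps -/

section Maps

theorem castSucc_succAbove_predAbove {n : ℕ} (i : Fin (n + 1)) (x : Fin (n + 2))
    (h : x ≠ i.castSucc) : i.castSucc.succAbove (i.predAbove x) = x := by
  have := Fin.val_ne_of_ne h
  simp only [Fin.val_castSucc] at this
  ext
  simp only [Fin.predAbove, Fin.succAbove, Fin.lt_def, Fin.val_castSucc]
  split_ifs <;> simp at * <;> omega

theorem castSucc_succAbove_predAbove_self {n : ℕ} (i : Fin (n + 1)) :
    i.castSucc.succAbove (i.predAbove i.castSucc) = i.succ := by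
  simp

theorem comp_castSucc_succAbove_predAbove {n : ℕ} {α : Type*} (f : Fin (n + 2) → α)
    (i : Fin (n + 1)) (h : f i.castSucc = f i.succ) (x : Fin (n + 2)) :
    f (i.castSucc.succAbove (i.predAbove x)) = f x := by
  by_cases hx : x = i.castSucc
  · rw [hx, castSucc_succAbove_predAbove_self, h]
  · rw [castSucc_succAbove_predAbove i x hx]

/-- A monotone map identifies two neighbours, or misses a value other than the last one, or is
the identity, or the inclusion that misses only the last value. -/
theorem monotone_cases {m n : ℕ} (f : Fin (m + 1) → Fin (n + 1)) (hf : Monotone f) :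
    (∃ i : Fin m, f i.castSucc = f i.succ) ∨ (∃ i : Fin n, ∀ x, f x ≠ i.castSucc) ∨
      ((n = m ∨ n = m + 1) ∧ ∀ x, (f x : ℕ) = x) := by
  by_cases h1 : ∃ i : Fin m, f i.castSucc = f i.succ
  · exact Or.inl h1
  by_cases h2 : ∃ i : Fin n, ∀ x, f x ≠ i.castSucc
  · exact Or.inr (Or.inl h2)
  push Not at h1 h2
  have hs : StrictMono f := Fin.strictMono_iff_lt_succ.2 fun i =>
    lt_of_le_of_ne (hf Fin.castSucc_lt_succ.le) (h1 i)
  have hle : ∀ x : Fin (m + 1), (x : ℕ) ≤ f x := by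
    intro x
    induction x using Fin.induction with
    | zero => simp
    | succ i ih =>
      have := Fin.lt_def.1 (hs (Fin.castSucc_lt_succ (i := i)))
      simp only [Fin.val_succ, Fin.val_castSucc] at *
      omega
  have heq : ∀ (l : ℕ) (x : Fin (m + 1)), (x : ℕ) = l → (f x : ℕ) = l := by
    intro l
    induction l using Nat.strong_induction_on with
    | _ l ih =>
      intro x hx
      by_cases hl : l < n
      · obtain ⟨y, hy⟩ := h2 ⟨l, hl⟩
        have hy' : (f y : ℕ) = l := congrArg Fin.val hy
        have := hle y
        by_cases hyl : (y : ℕ) < l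
        · have := ih y hyl y rfl
          omega
        · have : y = x := Fin.ext (by omega)
          rw [← this, hy']
      · have := hle x
        have := (f x).2
        omega
  have hm := heq m (Fin.last m) rfl
  have := (f (Fin.last m)).2
  refine Or.inr (Or.inr ⟨?_, fun x => heq _ x rfl⟩)
  by_contra hn
  obtain ⟨y, hy⟩ := h2 ⟨m + 1, by omega⟩
  have h3 := congrArg Fin.val hy
  have h4 := heq y y rfl
  simp only [Fin.castSucc_mk] at h3
  omega

/-- An antitone map identifies two neighbours, or misses a value other than the last one, or is
the reversal, or the reversal followed by the inclusion that misses only the last value. -/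
theorem antitone_cases {m n : ℕ} (f : Fin (m + 1) → Fin (n + 1)) (hf : Antitone f) :
    (∃ i : Fin m, f i.castSucc = f i.succ) ∨ (∃ i : Fin n, ∀ x, f x ≠ i.castSucc) ∨
      ((n = m ∨ n = m + 1) ∧ ∀ x, (f x : ℕ) = x.rev) := by
  rcases monotone_cases (f ∘ Fin.rev) (hf.comp Fin.rev_anti) with ⟨i, hi⟩ | ⟨i, hi⟩ | ⟨h, hi⟩
  · refine Or.inl ⟨i.rev, ?_⟩
    simp only [Function.comp_apply, Fin.rev_castSucc, Fin.rev_succ] at hi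
    exact hi.symm
  · exact Or.inr (Or.inl ⟨i, fun x => by simpa using hi x.rev⟩)
  · exact Or.inr (Or.inr ⟨h, fun x => by simpa using hi x.rev⟩)

end Maps

/-! ### The reversals of the two categories -/

section Reversals

open AlgebraicTopology.AlternatingCofaceMapComplex (objD)

variable (k : Type u) [CommRing k]

theorem simplex_elementary {m n : ℕ} (φ : ⦋m⦌ ⟶ ⦋n⦌) :
    IsElementary (k := k) (ι := 𝟭 SimplexCategory) (fun _ => 𝟙 _) (m := m) (n := n)
      ((Free.embedding k SimplexCategory).map φ) := by
  rcases monotone_cases φ.toOrderHom φ.toOrderHom.monotone with ⟨i, hi⟩ | ⟨i, hi⟩ | ⟨h, hi⟩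
  · obtain _ | m := m
    · exact i.elim0
    have : φ = SimplexCategory.σ i ≫ SimplexCategory.δ i.castSucc ≫ φ := by
      ext x : 3
      exact (comp_castSucc_succAbove_predAbove φ.toOrderHom i hi x).symm
    rw [this, Functor.map_comp]
    exact IsElementary.degenerate (ι := 𝟭 SimplexCategory) i _
  · obtain _ | n := n
    · exact i.elim0
    have : φ = (φ ≫ SimplexCategory.σ i) ≫ SimplexCategory.δ i.castSucc := by
      ext x : 3
      exact (castSucc_succAbove_predAbove i _ (hi x)).symm
    rw [this, Functor.map_comp]
    exact IsElementary.face (ι := 𝟭 SimplexCategory) i _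
  · rcases h with rfl | rfl
    · have : φ = 𝟙 _ := by
        ext x : 3
        exact Fin.ext (hi x)
      rw [this]
      exact IsElementary.id (ι := 𝟭 SimplexCategory) _
    · have : φ = SimplexCategory.δ (Fin.last (m + 1)) := by
        ext x : 3
        refine Fin.ext ((hi x).trans ?_)
        change _ = ((Fin.last (m + 1)).succAbove x : ℕ)
        simp
      rw [this]
      exact IsElementary.last (ι := 𝟭 SimplexCategory) _

/-- In the category of ordered sets, all morphisms are order-preserving, and the identities can
be taken as reversals. -/
def simplexReversal : SignedReversal k (𝟭 SimplexCategory) where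
  t _ := 𝟙 _
  t_comp_t _ := Category.comp_id _
  t_comp_σ i := ⟨i, 𝟙 _, (Category.id_comp _).trans (Category.comp_id _).symm⟩
  t_comp_objD _ := (Category.id_comp _).trans (Category.comp_id _).symm
  mem_span f := by
    induction f using free_hom_induction with
    | zero => exact zero_mem _
    | add f g hf hg => exact add_mem hf hg
    | smul r φ => exact Submodule.smul_mem _ _ (Submodule.subset_span (simplex_elementary k φ))

/-- The order-reversing bijection. -/
def BA.rev (n : ℕ) : simplexToBA.obj ⦋n⦌ ⟶ simplexToBA.obj ⦋n⦌ :=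
  ⟨Fin.rev, (BA.between_iff _).2 (Or.inr Fin.rev_anti)⟩

theorem BA.hom_ext {a b : BA} {f g : a ⟶ b} (h : ∀ x, f.toFun x = g.toFun x) : f = g :=
  BA.Hom.ext (funext h)

theorem BA.rev_comp_rev (n : ℕ) : BA.rev n ≫ BA.rev n = 𝟙 _ :=
  BA.hom_ext fun x => Fin.rev_rev x

theorem BA.rev_comp_σ {n : ℕ} (i : Fin (n + 1)) :
    BA.rev (n + 1) ≫ simplexToBA.map (SimplexCategory.σ i) =
      simplexToBA.map (SimplexCategory.σ i.rev) ≫ BA.rev n :=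
  BA.hom_ext fun x => Fin.predAbove_rev_right i x

theorem BA.rev_comp_δ {n : ℕ} (i : Fin (n + 2)) :
    BA.rev n ≫ simplexToBA.map (SimplexCategory.δ i) =
      simplexToBA.map (SimplexCategory.δ i.rev) ≫ BA.rev (n + 1) :=
  BA.hom_ext fun x => Fin.succAbove_rev_right i x

/-- The sign `(-1) ^ (n * (n + 1) / 2)`, by which the reversal has to be multiplied to commute
with the differentials. -/
def revSign (n : ℕ) : ℤ := (-1) ^ (∑ i ∈ Finset.range (n + 1), i)

theorem revSign_zero : revSign 0 = 1 := rfl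

theorem revSign_succ (n : ℕ) : revSign (n + 1) = revSign n * (-1) ^ (n + 1) := by
  rw [revSign, Finset.sum_range_succ, pow_add]
  rfl

theorem revSign_mul_self (n : ℕ) : revSign n * revSign n = 1 := by
  rw [revSign, ← mul_pow]
  simp

/-- The order-reversing bijection as a morphism of the linearization. -/
def linRev (n : ℕ) : LinHom k simplexToBA n n := (Free.embedding k BA).map (BA.rev n)

theorem linRev_comp_linRev (n : ℕ) : linRev k n ≫ linRev k n = 𝟙 _ :=
  ((Free.embedding k BA).map_comp _ _).symm.trans
    (congrArg (Free.embedding k BA).map (BA.rev_comp_rev n))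

theorem linRev_comp_σ {n : ℕ} (i : Fin (n + 1)) :
    linRev k (n + 1) ≫ (linearized k simplexToBA).σ i =
      (linearized k simplexToBA).σ i.rev ≫ linRev k n := by
  have := congrArg (Free.embedding k BA).map (BA.rev_comp_σ i)
  rw [Functor.map_comp, Functor.map_comp] at this
  exact this

theorem linRev_comp_δ {n : ℕ} (i : Fin (n + 2)) :
    linRev k n ≫ (linearized k simplexToBA).δ i =
      (linearized k simplexToBA).δ i.rev ≫ linRev k (n + 1) := by
  have := congrArg (Free.embedding k BA).map (BA.rev_comp_δ i)
  rw [Functor.map_comp, Functor.map_comp] at this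
  exact this

theorem linRev_comp_objD (n : ℕ) : linRev k n ≫ objD (linearized k simplexToBA) n =
    (-1 : ℤ) ^ (n + 1) • objD (linearized k simplexToBA) n ≫ linRev k (n + 1) := by
  rw [objD, Preadditive.comp_sum, Preadditive.sum_comp, Finset.smul_sum,
    ← Equiv.sum_comp Fin.revPerm]
  refine Finset.sum_congr rfl fun i _ => ?_
  have h2 : (-1 : ℤ) ^ (n + 1) * (-1) ^ (i : ℕ) = (-1) ^ (i.rev : ℕ) := by
    rw [← pow_add]
    refine neg_one_pow_congr ?_
    have := i.2
    simp only [Fin.val_rev, Nat.even_iff]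
    omega
  rw [Fin.revPerm_apply, Preadditive.comp_zsmul, linRev_comp_δ, Fin.rev_rev,
    Preadditive.zsmul_comp, smul_smul, h2]

theorem BA_elementary {m n : ℕ} (φ : simplexToBA.obj ⦋m⦌ ⟶ simplexToBA.obj ⦋n⦌) :
    (Free.embedding k BA).map φ ∈ Submodule.span k {g |
      IsElementary (ι := simplexToBA) (m := m) (n := n) (fun n => revSign n • linRev k n) g} := by
  have key : (∃ i : Fin m, φ.toFun i.castSucc = φ.toFun i.succ) ∨
      (∃ i : Fin n, ∀ x, φ.toFun x ≠ i.castSucc) ∨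
      ((n = m ∨ n = m + 1) ∧
        ((∀ x, (φ.toFun x : ℕ) = x) ∨ ∀ x, (φ.toFun x : ℕ) = Fin.rev x)) := by
    rcases (BA.between_iff φ.toFun).1 φ.between with hφ | hφ
    · rcases monotone_cases φ.toFun hφ with h | h | ⟨h, h'⟩
      · exact Or.inl h
      · exact Or.inr (Or.inl h)
      · exact Or.inr (Or.inr ⟨h, Or.inl h'⟩)
    · rcases antitone_cases φ.toFun hφ with h | h | ⟨h, h'⟩
      · exact Or.inl h
      · exact Or.inr (Or.inl h)
      · exact Or.inr (Or.inr ⟨h, Or.inr h'⟩)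
  rcases key with ⟨i, hi⟩ | ⟨i, hi⟩ | ⟨h, hi⟩
  · obtain _ | m := m
    · exact i.elim0
    have : φ = simplexToBA.map (SimplexCategory.σ i) ≫
        simplexToBA.map (SimplexCategory.δ i.castSucc) ≫ φ :=
      BA.hom_ext fun x => (comp_castSucc_succAbove_predAbove φ.toFun i hi x).symm
    rw [this, Functor.map_comp]
    exact Submodule.subset_span (IsElementary.degenerate i _)
  · obtain _ | n := n
    · exact i.elim0
    have : φ = (φ ≫ simplexToBA.map (SimplexCategory.σ i)) ≫
        simplexToBA.map (SimplexCategory.δ i.castSucc) :=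
      BA.hom_ext fun x => (castSucc_succAbove_predAbove i _ (hi x)).symm
    rw [this, Functor.map_comp]
    exact Submodule.subset_span (IsElementary.face i _)
  · rcases h with rfl | rfl
    · rcases hi with hi | hi
      · have : φ = 𝟙 _ := BA.hom_ext fun x => Fin.ext (hi x)
        rw [this]
        exact Submodule.subset_span (IsElementary.id _)
      · have : φ = BA.rev n := BA.hom_ext fun x => Fin.ext (hi x)
        have h2 : (Free.embedding k BA).map φ = revSign n • (revSign n • linRev k n) := by
          rw [this, smul_smul, revSign_mul_self, one_smul]
          rfl
        rw [h2]
        exact zsmul_mem (Submodule.subset_span (IsElementary.reversal n)) _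
    · rcases hi with hi | hi
      · have : φ = simplexToBA.map (SimplexCategory.δ (Fin.last (m + 1))) :=
          BA.hom_ext fun x => Fin.ext ((hi x).trans
            (congrArg Fin.val (Fin.succAbove_last_apply (n := m + 1) x)).symm)
        rw [this]
        exact Submodule.subset_span (IsElementary.last _)
      · have : φ = BA.rev m ≫ simplexToBA.map (SimplexCategory.δ (Fin.last (m + 1))) :=
          BA.hom_ext fun x => Fin.ext ((hi x).trans
            (congrArg Fin.val (Fin.succAbove_last_apply (n := m + 1) (Fin.rev x))).symm)
        have h2 : (Free.embedding k BA).map φ = revSign m • ((revSign m • linRev k m) ≫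
            (linearized k simplexToBA).δ (Fin.last (m + 1))) := by
          rw [this, Preadditive.zsmul_comp, smul_smul, revSign_mul_self, one_smul,
            Functor.map_comp]
          rfl
        rw [h2]
        exact zsmul_mem (Submodule.subset_span (IsElementary.reversal_last m)) _

/-- The order-reversing bijections, with signs. -/
def BAReversal : SignedReversal k simplexToBA where
  t n := revSign n • linRev k n
  t_comp_t n := by
    rw [Preadditive.zsmul_comp, Preadditive.comp_zsmul, smul_smul, revSign_mul_self, one_smul,
      linRev_comp_linRev]
  t_comp_σ {n} i := by
    refine ⟨i.rev, revSign (n + 1) • linRev k n, ?_⟩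
    rw [Preadditive.zsmul_comp, Preadditive.comp_zsmul, linRev_comp_σ]
  t_comp_objD n := by
    rw [Preadditive.zsmul_comp, Preadditive.comp_zsmul, linRev_comp_objD, smul_smul, revSign_succ]
  mem_span f := by
    induction f using free_hom_induction with
    | zero => exact zero_mem _
    | add f g hf hg => exact add_mem hf hg
    | smul r φ => exact Submodule.smul_mem _ _ (BA_elementary k φ)

end Reversals

/-! ### Representations of the group with two elements -/

section C₂

variable {k : Type u} [CommRing k]

/-- The generator of the group with two elements. -/
def γ : C₂ := Multiplicative.ofAdd 1

theorem γ_mul_γ : γ * γ = 1 := rfl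

theorem C₂.eq_one_or_eq_γ (g : C₂) : g = 1 ∨ g = γ := by
  revert g
  decide

theorem rep_γ_γ (A : Rep.{v} k C₂) (x : A) : A.ρ γ (A.ρ γ x) = x := by
  rw [← Module.End.mul_apply, ← map_mul, γ_mul_γ, map_one, Module.End.one_apply]

/-- A linear map that commutes with the action of the generator is a map of representations. -/
def c₂Hom {A B : Rep.{v} k C₂} (f : A →ₗ[k] B) (h : ∀ x, f (A.ρ γ x) = B.ρ γ (f x)) : A ⟶ B :=
  Rep.ofHom ⟨f, fun g => by
    rcases C₂.eq_one_or_eq_γ g with rfl | rfl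
    · rw [map_one, map_one]
      rfl
    · ext x
      exact h x⟩

theorem rep_hom_ext {A B : Rep.{v} k C₂} {f g : A ⟶ B} (h : ∀ x, f.hom x = g.hom x) : f = g := by
  ext x
  exact h x

theorem isTrivial_of_γ {A : Rep.{v} k C₂} (h : ∀ x, A.ρ γ x = x) : A.ρ.IsTrivial := by
  refine ⟨fun g => ?_⟩
  rcases C₂.eq_one_or_eq_γ g with rfl | rfl
  · rw [map_one]
    rfl
  · ext x
    exact h x

/-- The representation in which the generator acts through a given involution. -/
def c₂Rep {A : Type v} [AddCommGroup A] [Module k A] (s : A →ₗ[k] A) (h : ∀ x, s (s x) = x) :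
    Rep.{v} k C₂ :=
  Rep.of (X := A)
    { toFun := fun g => if g = 1 then 1 else s
      map_one' := if_pos rfl
      map_mul' := fun g g' => by
        have hγ : γ ≠ 1 := by decide
        rcases C₂.eq_one_or_eq_γ g with rfl | rfl
        · rw [one_mul, if_pos rfl, one_mul]
        · rcases C₂.eq_one_or_eq_γ g' with rfl | rfl
          · rw [mul_one, if_pos rfl, mul_one]
          · rw [γ_mul_γ, if_pos rfl, if_neg hγ]
            ext x
            exact (h x).symm }

theorem c₂Rep_ρ_γ {A : Type v} [AddCommGroup A] [Module k A] (s : A →ₗ[k] A)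
    (h : ∀ x, s (s x) = x) (x : A) : (c₂Rep s h).ρ γ x = s x := by
  have hγ : γ ≠ 1 := by decide
  change (if γ = 1 then 1 else s : A →ₗ[k] A) x = s x
  rw [if_neg hγ]

end C₂

/-! ### Modules over the normalized category with values given by a complex -/

section Functional

open AlgebraicTopology.AlternatingCofaceMapComplex (objD)

variable {k : Type u} [CommRing k] (V : CochainComplex (Rep.{v} k C₂) ℕ)

/-- The canonical map between the terms of a complex in equal degrees. -/
def xIso (m n : ℕ) : V.X m ⟶ V.X n := if h : m = n then eqToHom (by rw [h]) else 0

open Classical in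
/-- The action on the complex `V` of the maps of finite sets; the linear extension of its
restriction to the betweenness-preserving maps is multiplicative on the normalized category. Only
the identity, the reversal, the first coface map and the reversal followed by the latter act, all
other maps are sent to `0`. -/
def basisAction {m n : ℕ} (f : Fin (m + 1) → Fin (n + 1)) : V.X m ⟶ V.X n :=
  (if ∀ x, (f x : ℕ) = x then xIso V m n else
    if ∀ x, (f x : ℕ) = Fin.rev x then revSign m • (V.X m).applyAsHom γ ≫ xIso V m n else 0) +
  (if ∀ x, (f x : ℕ) = x + 1 then V.d m n else
    if ∀ x, (f x : ℕ) = Fin.rev x + 1 then revSign m • (V.X m).applyAsHom γ ≫ V.d m n else 0)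

theorem basisAction_eq_zero {m n : ℕ} (f : Fin (m + 1) → Fin (n + 1))
    (i : Fin m) (h : f i.castSucc = f i.succ) : basisAction V f = 0 := by
  have h' := congrArg Fin.val h
  have hi := i.2
  rw [basisAction, if_neg, if_neg, if_neg, if_neg, add_zero]
  all_goals
    intro H
    have h1 := H i.castSucc
    have h2 := H i.succ
    simp only [Fin.val_rev, Fin.val_castSucc, Fin.val_succ] at h1 h2
    omega

theorem basisAction_id (n : ℕ) : basisAction V (id : Fin (n + 1) → Fin (n + 1)) = 𝟙 _ := by
  rw [basisAction, if_pos, if_neg, if_neg, add_zero, xIso, dif_pos rfl, eqToHom_refl]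
  · intro H
    have h1 := H 0
    simp at h1
  · intro H
    have h1 := H 0
    simp at h1
  · intro x
    rfl

theorem basisAction_succAbove_of_ne {n : ℕ} (i : Fin (n + 2)) (hi : i ≠ 0) :
    basisAction V i.succAbove = 0 := by
  have h0 : i.succAbove 0 = 0 := Fin.succAbove_ne_zero_zero hi
  rw [basisAction, if_neg (c := ∀ x, (i.succAbove x : ℕ) = x + 1),
    if_neg (c := ∀ x : Fin (n + 1), (i.succAbove x : ℕ) = Fin.rev x + 1), add_zero, xIso,
    dif_neg (by omega), Limits.comp_zero, smul_zero, ite_self, ite_self]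
  · intro H
    have h1 := H 0
    rw [h0] at h1
    simp at h1
  · intro H
    have h1 := H 0
    rw [h0] at h1
    simp at h1

theorem basisAction_succAbove_zero (n : ℕ) :
    basisAction V (Fin.succAbove (0 : Fin (n + 2))) = V.d n (n + 1) := by
  rw [basisAction, if_pos (c := ∀ x, (Fin.succAbove (0 : Fin (n + 2)) x : ℕ) = x + 1), xIso,
    dif_neg (by omega), Limits.comp_zero, smul_zero, ite_self, ite_self, zero_add]
  intro x
  simp

theorem basisAction_succAbove_comp_rev_of_ne {n : ℕ} (i : Fin (n + 2)) (hi : i ≠ 0) :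
    basisAction V (i.succAbove ∘ Fin.rev) = 0 := by
  have h0 : (i.succAbove ∘ Fin.rev) (Fin.last n) = 0 := by
    rw [Function.comp_apply, Fin.rev_last, Fin.succAbove_ne_zero_zero hi]
  rw [basisAction, if_neg (c := ∀ x, ((i.succAbove ∘ Fin.rev) x : ℕ) = x + 1),
    if_neg (c := ∀ x, ((i.succAbove ∘ Fin.rev) x : ℕ) = Fin.rev x + 1), add_zero, xIso,
    dif_neg (by omega), Limits.comp_zero, smul_zero, ite_self, ite_self]
  · intro H
    have h1 := H (Fin.last n)
    rw [h0] at h1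
    simp at h1
  · intro H
    have h1 := H (Fin.last n)
    rw [h0] at h1
    simp at h1

section

variable (hV : (V.X 0).ρ.IsTrivial)
include hV

theorem applyAsHom_γ_zero : (V.X 0).applyAsHom γ = 𝟙 _ :=
  rep_hom_ext fun x => by
    change (V.X 0).ρ γ x = x
    rw [hV.out]
    rfl

/-- On one point the reversal is the identity; this is where the action of `C₂` on the first term
of the complex has to be trivial. -/
theorem basisAction_rev (n : ℕ) :
    basisAction V (Fin.rev : Fin (n + 1) → Fin (n + 1)) =
      revSign n • (V.X n).applyAsHom γ := by
  rw [basisAction, if_neg (c := ∀ x : Fin (n + 1), (Fin.rev x : ℕ) = x + 1),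
    if_neg (c := ∀ x : Fin (n + 1), (Fin.rev x : ℕ) = Fin.rev x + 1), add_zero, xIso, dif_pos rfl,
    eqToHom_refl, if_pos (c := ∀ x : Fin (n + 1), (Fin.rev x : ℕ) = Fin.rev x) (fun _ => rfl),
    Category.comp_id]
  · split_ifs with h
    · obtain rfl : n = 0 := by simpa using h 0
      rw [applyAsHom_γ_zero V hV, revSign_zero, one_smul]
    · rfl
  · intro H
    have h1 := H 0
    omega
  · intro H
    have h1 := H (Fin.last n)
    simp at h1

theorem basisAction_succAbove_zero_comp_rev (n : ℕ) :
    basisAction V (Fin.succAbove (0 : Fin (n + 2)) ∘ Fin.rev) =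
      revSign n • (V.X n).applyAsHom γ ≫ V.d n (n + 1) := by
  rw [basisAction, xIso, dif_neg (by omega), Limits.comp_zero, smul_zero, ite_self, ite_self,
    zero_add]
  split_ifs with h h'
  · obtain rfl : n = 0 := by simpa using h 0
    rw [applyAsHom_γ_zero V hV, revSign_zero, one_smul, Category.id_comp]
  · rfl
  · exact absurd (fun x => by simp) h'

end

/-- The linear extension of `basisAction`. -/
def linAction (m n : ℕ) : LinHom k simplexToBA m n →ₗ[k] (V.X m ⟶ V.X n) :=
  freeHomLift (k := k) (C := BA) (X := simplexToBA.obj ⦋m⦌) (Y := simplexToBA.obj ⦋n⦌)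
    fun φ => basisAction V (m := m) (n := n) φ.toFun

theorem linAction_embedding {m n : ℕ} (φ : simplexToBA.obj ⦋m⦌ ⟶ simplexToBA.obj ⦋n⦌) :
    linAction V m n ((Free.embedding k BA).map φ) = basisAction V (m := m) (n := n) φ.toFun :=
  freeHomLift_embedding (k := k) (C := BA) (X := simplexToBA.obj ⦋m⦌) (Y := simplexToBA.obj ⦋n⦌)
    (fun φ : simplexToBA.obj ⦋m⦌ ⟶ simplexToBA.obj ⦋n⦌ =>
      basisAction V (m := m) (n := n) φ.toFun) φ

theorem linAction_σ_comp {m n : ℕ} (i : Fin (m + 1)) (f : LinHom k simplexToBA m n) :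
    linAction V (m + 1) n ((linearized k simplexToBA).σ i ≫ f) = 0 := by
  suffices h : linAction V (m + 1) n ∘ₗ
      Linear.leftComp k _ ((linearized k simplexToBA).σ i) = 0 from congrArg (fun t => t f) h
  refine free_hom_ext (k := k) (C := BA) (X := simplexToBA.obj ⦋m⦌) (Y := simplexToBA.obj ⦋n⦌)
    fun φ => ?_
  have : (linearized k simplexToBA).σ i ≫ (Free.embedding k BA).map φ =
      (Free.embedding k BA).map (simplexToBA.map (SimplexCategory.σ i) ≫ φ) :=
    ((Free.embedding k BA).map_comp _ _).symm
  refine (congrArg (linAction V (m + 1) n) this).trans ?_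
  refine (linAction_embedding V _).trans (basisAction_eq_zero V _ i ?_)
  change φ.toFun (i.predAbove i.castSucc) = φ.toFun (i.predAbove i.succ)
  rw [Fin.predAbove_castSucc_self, Fin.predAbove_succ_self]

/-- The action does not see `Ψₘ`, which differs from the identity by maps that factor through
codegeneracies. -/
theorem linAction_normalizer_comp {m n : ℕ} (f : LinHom k simplexToBA m n) :
    linAction V m n (normalizer (linearized k simplexToBA) m ≫ f) = linAction V m n f := by
  cases m with
  | zero => exact congrArg _ (Category.id_comp f)
  | succ m =>
    conv_rhs => rw [← Category.id_comp f,
      ← normalizerAux_add_sum (linearized k simplexToBA) (m + 1) le_rfl]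
    rw [Preadditive.add_comp, map_add, Preadditive.sum_comp, map_sum, Finset.sum_eq_zero, add_zero]
    · rfl
    · intro i _
      rw [Category.assoc]
      exact linAction_σ_comp V _ _

theorem linAction_id (n : ℕ) : linAction V n n (𝟙 _) = 𝟙 _ :=
  (linAction_embedding V (𝟙 _)).trans (basisAction_id V n)

theorem linAction_δ {n : ℕ} (i : Fin (n + 2)) :
    linAction V n (n + 1) ((linearized k simplexToBA).δ i) = basisAction V i.succAbove :=
  linAction_embedding V (simplexToBA.map (SimplexCategory.δ i))

theorem linAction_linRev_comp_δ {n : ℕ} (i : Fin (n + 2)) :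
    linAction V n (n + 1) (linRev k n ≫ (linearized k simplexToBA).δ i) =
      basisAction V (i.succAbove ∘ Fin.rev) := by
  have : linRev k n ≫ (linearized k simplexToBA).δ i =
      (Free.embedding k BA).map (BA.rev n ≫ simplexToBA.map (SimplexCategory.δ i)) :=
    ((Free.embedding k BA).map_comp _ _).symm
  rw [this]
  exact linAction_embedding V _

theorem linAction_objD (n : ℕ) :
    linAction V n (n + 1) (objD (linearized k simplexToBA) n) = V.d n (n + 1) := by
  rw [objD, map_sum, Finset.sum_eq_single 0]
  · rw [map_zsmul, linAction_δ, basisAction_succAbove_zero]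
    simp
  · intro i _ hi
    rw [map_zsmul, linAction_δ, basisAction_succAbove_of_ne V i hi, smul_zero]
  · simp

variable (hV : (V.X 0).ρ.IsTrivial)
include hV

theorem linAction_t (n : ℕ) :
    linAction V n n ((BAReversal k).t n) = (V.X n).applyAsHom γ := by
  change linAction V n n (revSign n • linRev k n) = _
  rw [map_zsmul, linRev]
  refine (congrArg (revSign n • ·) ((linAction_embedding V (BA.rev n)).trans
    (basisAction_rev V hV n))).trans ?_
  change revSign n • (revSign n • _) = _
  rw [smul_smul, revSign_mul_self, one_smul]

theorem linAction_t_comp_objD (n : ℕ) :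
    linAction V n (n + 1) ((BAReversal k).t n ≫ objD (linearized k simplexToBA) n) =
      (V.X n).applyAsHom γ ≫ V.d n (n + 1) := by
  change linAction V n (n + 1) ((revSign n • linRev k n) ≫ _) = _
  rw [Preadditive.zsmul_comp, map_zsmul, objD, Preadditive.comp_sum, map_sum,
    Finset.sum_eq_single 0]
  · rw [Preadditive.comp_zsmul, map_zsmul, linAction_linRev_comp_δ,
      basisAction_succAbove_zero_comp_rev V hV]
    simp only [Fin.val_zero, pow_zero, one_smul]
    rw [smul_smul, revSign_mul_self, one_smul]
  · intro i _ hi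
    rw [Preadditive.comp_zsmul, map_zsmul, linAction_linRev_comp_δ,
      basisAction_succAbove_comp_rev_of_ne V i hi, smul_zero]
  · simp

end Functional

section ModuleOfComplex

open AlgebraicTopology.AlternatingCofaceMapComplex (objD)

variable {k : Type u} [CommRing k] (V : CochainComplex (Rep.{v} k C₂) ℕ)

/-- The action of the morphisms of the normalized category on the terms of a complex. -/
def nAction (m n : ℕ) :
    (nObj k simplexToBA m ⟶ nObj k simplexToBA n) →ₗ[k] (V.X m ⟶ V.X n) where
  toFun f := linAction V m n f.hom.f
  map_add' f g := map_add (linAction V m n) f.hom.f g.hom.f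
  map_smul' r f := map_smul (linAction V m n) r f.hom.f

theorem nAction_apply {m n : ℕ} (f : nObj k simplexToBA m ⟶ nObj k simplexToBA n) :
    nAction V m n f = linAction V m n f.hom.f := rfl

theorem nAction_id (n : ℕ) : nAction V n n (𝟙 _) = 𝟙 _ := by
  refine Eq.trans ?_ (linAction_id V n)
  refine Eq.trans ?_ (linAction_normalizer_comp V (𝟙 _))
  exact congrArg (linAction V n n) (Category.comp_id _).symm

theorem nAction_nD (n : ℕ) : nAction V n (n + 1) (nD k simplexToBA n) = V.d n (n + 1) := by
  rw [nAction_apply, nD_hom_f, linAction_normalizer_comp, linAction_objD]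

variable (hV : (V.X 0).ρ.IsTrivial)
include hV

theorem nAction_nT (n : ℕ) : nAction V n n ((BAReversal k).nT n) = (V.X n).applyAsHom γ := by
  rw [nAction_apply, SignedReversal.nT_hom_f, linAction_normalizer_comp, linAction_t V hV]

theorem nAction_nT_comp_nD (n : ℕ) :
    nAction V n (n + 1) ((BAReversal k).nT n ≫ nD k simplexToBA n) =
      (V.X n).applyAsHom γ ≫ V.d n (n + 1) := by
  have : ((BAReversal k).nT n ≫ nD k simplexToBA n).hom.f =
      normalizer (linearized k simplexToBA) n ≫ (BAReversal k).t n ≫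
        objD (linearized k simplexToBA) n := by
    change ((BAReversal k).nT n).hom.f ≫ (nD k simplexToBA n).hom.f = _
    rw [nD_hom_f, SignedReversal.nT_hom_f, ← Category.assoc,
      SignedReversal.normalizer_comp_t_comp_normalizer, Category.assoc]
  rw [nAction_apply, this, linAction_normalizer_comp, linAction_t_comp_objD V hV]

/-- The reversals and differentials of the normalized category satisfy the same relations as the
action of `γ` and the differentials of the complex: both reversals are involutions, both
differentials have square zero, and the former commute with the latter. -/
theorem nAction_comp_of_isBasic {l m n : ℕ} {f : nObj k simplexToBA l ⟶ nObj k simplexToBA m}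
    {g : nObj k simplexToBA m ⟶ nObj k simplexToBA n} (hf : (BAReversal k).IsBasic f)
    (hg : (BAReversal k).IsBasic g) :
    nAction V l n (f ≫ g) = nAction V l m f ≫ nAction V m n g := by
  have hT := nAction_nT V hV
  have hD := nAction_nD V
  have hTD := nAction_nT_comp_nD V hV
  have hdd : ∀ n, V.d n (n + 1) ≫ V.d (n + 1) (n + 1 + 1) = 0 := fun n => V.d_comp_d _ _ _
  have hTT := (BAReversal k).nT_comp_nT
  have hDT := (BAReversal k).nD_comp_nT
  have hDD := nD_comp_nD k simplexToBA
  have hss : ∀ n, (V.X n).applyAsHom γ ≫ (V.X n).applyAsHom γ = 𝟙 _ := fun n =>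
    rep_hom_ext fun x => rep_γ_γ _ x
  have hds : ∀ n, V.d n (n + 1) ≫ (V.X (n + 1)).applyAsHom γ =
    (V.X n).applyAsHom γ ≫ V.d n (n + 1) := fun n => (Rep.applyAsHom_comm _ _).symm
  cases hf with
  | id => rw [nAction_id, Category.id_comp, Category.id_comp]
  | nT =>
    cases hg with
    | id => rw [nAction_id, Category.comp_id, Category.comp_id]
    | nT => rw [hTT, nAction_id, hT, hss]
    | nD => rw [hTD, hT, hD]
    | nT_nD => rw [← Category.assoc, hTT, Category.id_comp, hTD, hT, hD, ← Category.assoc, hss,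
        Category.id_comp]
  | nD =>
    cases hg with
    | id => rw [nAction_id, Category.comp_id, Category.comp_id]
    | nT => rw [hDT, hTD, hT, hD, hds]
    | nD => rw [hDD, map_zero, hD, hD, hdd]
    | nT_nD => rw [← Category.assoc, hDT, Category.assoc, hDD, Limits.comp_zero, map_zero, hD, hTD,
        ← Category.assoc, hds, Category.assoc, hdd, Limits.comp_zero]
  | nT_nD =>
    cases hg with
    | id => rw [nAction_id, Category.comp_id, Category.comp_id]
    | nT => rw [Category.assoc, hDT, ← Category.assoc, hTT, Category.id_comp, hD, hTD, hT,
        Category.assoc, hds, ← Category.assoc, hss, Category.id_comp]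
    | nD => rw [Category.assoc, hDD, Limits.comp_zero, map_zero, hD, hTD, Category.assoc, hdd,
        Limits.comp_zero]
    | nT_nD => rw [Category.assoc, ← Category.assoc (nD _ _ _), hDT, Category.assoc, hDD,
        Limits.comp_zero, Limits.comp_zero, map_zero, hTD, hTD, Category.assoc,
        ← Category.assoc (V.d _ _), hds, Category.assoc, hdd, Limits.comp_zero, Limits.comp_zero]

theorem nAction_comp {l m n : ℕ} (f : nObj k simplexToBA l ⟶ nObj k simplexToBA m)
    (g : nObj k simplexToBA m ⟶ nObj k simplexToBA n) :
    nAction V l n (f ≫ g) = nAction V l m f ≫ nAction V m n g := by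
  induction (BAReversal k).mem_span_isBasic f using Submodule.span_induction with
  | zero => rw [Limits.zero_comp, map_zero, map_zero, Limits.zero_comp]
  | add a b _ _ ha hb =>
    rw [Preadditive.add_comp, map_add, map_add, ha, hb, Preadditive.add_comp]
  | smul r a _ ha => rw [Linear.smul_comp, map_smul, map_smul, ha, Linear.smul_comp]
  | mem a ha =>
    induction (BAReversal k).mem_span_isBasic g using Submodule.span_induction with
    | zero => rw [Limits.comp_zero, map_zero, map_zero, Limits.comp_zero]
    | add b c _ _ hb hc =>
      rw [Preadditive.comp_add, map_add, map_add, hb, hc, Preadditive.comp_add]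
    | smul r b _ hb => rw [Linear.comp_smul, map_smul, map_smul, hb, Linear.comp_smul]
    | mem b hb => exact nAction_comp_of_isBasic V hV ha hb

/-- The module over the normalized category of `BA` that is defined by a complex. -/
def moduleOfComplex : LinearModules.{u, v} k (Normalized k simplexToBA) where
  obj :=
    { obj := fun n : ℕ => V.X n
      map := fun {m n} f => nAction V m n f
      map_id := fun n => nAction_id V n
      map_comp := fun {l m n} f g => nAction_comp V hV (l := l) (m := m) (n := n) f g } ⋙
    forget₂ (Rep k C₂) (ModuleCat k)
  property := by
    refine ⟨⟨fun {m n f g} => ?_⟩, ⟨fun {m n} f r => ?_⟩⟩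
    · exact (congrArg (forget₂ (Rep k C₂) (ModuleCat k)).map (map_add (nAction V m n) f g)).trans
        (Functor.map_add _)
    · exact (congrArg (forget₂ (Rep k C₂) (ModuleCat k)).map (map_smul (nAction V m n) r f)).trans
        (Functor.map_smul _ _ _)

end ModuleOfComplex

/-! ### Modules over the normalized category of `BA` and twofold complexes -/

section TwofoldEquivalence

variable {k : Type u} [CommRing k]

/-- A family of maps that is compatible with the differentials and the reversals is a
transformation of modules over the normalized category. -/
theorem naturality_of_generators {C : Type} [Category.{0} C] {ι : SimplexCategory ⥤ C}
    (R : SignedReversal k ι) {F G : Normalized k ι ⥤ ModuleCat.{v} k} [F.Additive] [G.Additive]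
    [F.Linear k] [G.Linear k] (η : ∀ n : ℕ, F.obj (nObj k ι n) ⟶ G.obj (nObj k ι n))
    (hT : ∀ n, F.map (R.nT n) ≫ η n = η n ≫ G.map (R.nT n))
    (hD : ∀ n, F.map (nD k ι n) ≫ η (n + 1) = η n ≫ G.map (nD k ι n)) {m n : ℕ}
    (f : nObj k ι m ⟶ nObj k ι n) : F.map f ≫ η n = η m ≫ G.map f := by
  induction R.mem_span_isBasic f using Submodule.span_induction with
  | zero => rw [F.map_zero, G.map_zero, Limits.zero_comp, Limits.comp_zero]
  | add a b _ _ ha hb =>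
    rw [F.map_add, G.map_add, Preadditive.add_comp, ha, hb, Preadditive.comp_add]
  | smul r a _ ha => rw [F.map_smul, G.map_smul, Linear.smul_comp, ha, Linear.comp_smul]
  | mem a ha =>
    cases ha with
    | id => rw [F.map_id, G.map_id, Category.id_comp, Category.comp_id]
    | nT => exact hT _
    | nD => exact hD _
    | nT_nD =>
      rw [F.map_comp, G.map_comp, Category.assoc, hD, ← Category.assoc, hT, Category.assoc]

theorem module_hom_congr {A B : ModuleCat.{v} k} {f g : A ⟶ B} (h : f = g) (x : A) :
    f.hom x = g.hom x := by rw [h]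

variable (F : LinearModules.{u, v} k (Normalized k simplexToBA))

theorem map_nT_map_nT (n : ℕ) (x : F.obj.obj (nObj k simplexToBA n)) :
    (F.obj.map ((BAReversal k).nT n)).hom ((F.obj.map ((BAReversal k).nT n)).hom x) = x := by
  rw [← ModuleCat.comp_apply, ← F.obj.map_comp, SignedReversal.nT_comp_nT, F.obj.map_id]
  rfl

/-- The value of a module at the object `n`, with the action of the reversal. -/
def valueRep (n : ℕ) : Rep.{v} k C₂ :=
  c₂Rep (A := F.obj.obj (nObj k simplexToBA n)) (F.obj.map ((BAReversal k).nT n)).hom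
    (map_nT_map_nT F n)

theorem valueRep_ρ_γ (n : ℕ) (x : F.obj.obj (nObj k simplexToBA n)) :
    (valueRep F n).ρ γ x = (F.obj.map ((BAReversal k).nT n)).hom x :=
  c₂Rep_ρ_γ _ _ _

/-- The differential between the values of a module. -/
def valueD (n : ℕ) : valueRep F n ⟶ valueRep F (n + 1) :=
  c₂Hom (A := valueRep F n) (B := valueRep F (n + 1)) (F.obj.map (nD k simplexToBA n)).hom
    fun x => by
      refine (congrArg _ (valueRep_ρ_γ F n x)).trans
        (Eq.trans ?_ (valueRep_ρ_γ F (n + 1) _).symm)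
      exact module_hom_congr ((F.obj.map_comp _ _).symm.trans ((congrArg F.obj.map
        ((BAReversal k).nD_comp_nT n).symm).trans (F.obj.map_comp _ _))) x

theorem BAReversal_nT_zero : (BAReversal k).nT 0 = 𝟙 (nObj k simplexToBA 0) := by
  apply normalized_hom_ext
  rw [SignedReversal.nT_hom_f]
  refine (Category.id_comp _).trans ((one_smul ℤ (linRev k 0)).trans ?_)
  refine (congrArg (Free.embedding k BA).map (?_ : BA.rev 0 = 𝟙 _)).trans
    ((Free.embedding k BA).map_id _)
  exact BA.hom_ext fun x => Subsingleton.elim (α := Fin 1) _ _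

/-- The complex defined by a module over the normalized category of `BA`. -/
def twofoldComplex : TwofoldComplexes.{u, v} k where
  obj := CochainComplex.of (valueRep F) (valueD F) fun n => rep_hom_ext fun x => by
    have := F.property.1
    exact module_hom_congr ((F.obj.map_comp _ _).symm.trans ((congrArg F.obj.map
        (nD_comp_nD k simplexToBA n)).trans (F.obj.map_zero _ _))) x
  property := isTrivial_of_γ (A := valueRep F 0) fun x =>
    (valueRep_ρ_γ F 0 x).trans (module_hom_congr
      ((congrArg F.obj.map BAReversal_nT_zero).trans (F.obj.map_id _)) x)

theorem twofoldComplex_d (n : ℕ) : (twofoldComplex F).obj.d n (n + 1) = valueD F n :=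
  CochainComplex.of_d _ _ _

variable {F} {G : LinearModules.{u, v} k (Normalized k simplexToBA)}

/-- The map of representations between the values of two modules. -/
def valueMap (η : F ⟶ G) (n : ℕ) : valueRep F n ⟶ valueRep G n :=
  c₂Hom (A := valueRep F n) (B := valueRep G n) (η.hom.app (nObj k simplexToBA n)).hom fun x => by
    refine (congrArg _ (valueRep_ρ_γ F n x)).trans (Eq.trans ?_ (valueRep_ρ_γ G n _).symm)
    exact module_hom_congr (η.hom.naturality ((BAReversal k).nT n)) x

variable (k) in
/-- The functor that sends a module over the normalized category of `BA` to the complex of its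
values. -/
def twofoldFunctor : LinearModules.{u, v} k (Normalized k simplexToBA) ⥤
    TwofoldComplexes.{u, v} k where
  obj F := twofoldComplex F
  map {F G} η := ObjectProperty.homMk (CochainComplex.ofHom (valueMap η) fun n => by
    rw [twofoldComplex_d, twofoldComplex_d]
    exact rep_hom_ext fun x =>
      (module_hom_congr (η.hom.naturality (nD k simplexToBA n)) x).symm)

instance : (twofoldFunctor.{u, v} k).Additive where

instance : (twofoldFunctor.{u, v} k).Linear k where

instance : (twofoldFunctor.{u, v} k).Faithful where
  map_injective {F G} η θ h := by
    apply ObjectProperty.hom_ext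
    ext n x
    exact congrArg (fun t => (t.hom.f n).hom x) h

instance : (twofoldFunctor.{u, v} k).Full where
  map_surjective {F G} θ := by
    have := F.property.1
    have := F.property.2
    have := G.property.1
    have := G.property.2
    let η : ∀ n : ℕ, F.obj.obj (nObj k simplexToBA n) ⟶ G.obj.obj (nObj k simplexToBA n) :=
      fun n => ModuleCat.ofHom (θ.hom.f n).hom.toLinearMap
    have hT : ∀ n, F.obj.map ((BAReversal k).nT n) ≫ η n =
        η n ≫ G.obj.map ((BAReversal k).nT n) := fun n => by
      ext x
      refine (congrArg _ (valueRep_ρ_γ F n x)).symm.trans (Eq.trans ?_ (valueRep_ρ_γ G n _))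
      exact Rep.hom_comm_apply (θ.hom.f n) γ x
    have hD : ∀ n, F.obj.map (nD k simplexToBA n) ≫ η (n + 1) =
        η n ≫ G.obj.map (nD k simplexToBA n) := fun n => by
      have := θ.hom.comm n (n + 1)
      erw [twofoldComplex_d, twofoldComplex_d] at this
      ext x
      exact congrArg (fun t => t.hom x) this.symm
    refine ⟨ObjectProperty.homMk ⟨η, fun m n f =>
      naturality_of_generators (BAReversal k) η hT hD f⟩, ?_⟩
    apply ObjectProperty.hom_ext
    ext n x
    rfl

/-- A complex is isomorphic to the complex of values of the module it defines. -/
def twofoldComplexIso (V : TwofoldComplexes.{u, v} k) :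
    twofoldComplex (moduleOfComplex V.obj V.property) ≅ V :=
  ObjectProperty.isoMk _ (HomologicalComplex.Hom.isoOfComponents
    (fun n =>
      have h : ∀ x : V.obj.X n, (valueRep (moduleOfComplex V.obj V.property) n).ρ γ x =
          (V.obj.X n).ρ γ x := fun x =>
        (valueRep_ρ_γ (moduleOfComplex V.obj V.property) n x).trans
          (congrArg (fun t => t.hom x) (nAction_nT V.obj V.property n))
      { hom := c₂Hom (A := valueRep (moduleOfComplex V.obj V.property) n) (B := V.obj.X n)
          LinearMap.id h
        inv := c₂Hom (A := V.obj.X n) (B := valueRep (moduleOfComplex V.obj V.property) n)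
          LinearMap.id fun x => (h x).symm
        hom_inv_id := rfl
        inv_hom_id := rfl })
    (by
      rintro m _ rfl
      refine rep_hom_ext fun x => ?_
      have := congrArg (fun t => t.hom x) (twofoldComplex_d (moduleOfComplex V.obj V.property) m)
      exact (congrArg (fun t => t.hom x) (nAction_nD V.obj m)).symm.trans this.symm))

instance : (twofoldFunctor.{u, v} k).EssSurj where
  mem_essImage V := ⟨_, ⟨twofoldComplexIso V⟩⟩

end TwofoldEquivalence

/-! ### The normalized category of ordered sets inside the one of betweenness structures -/

section NormalizedMap

open AlgebraicTopology.AlternatingCofaceMapComplex (objD)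

variable (k : Type u) [CommRing k]

/-- The linearization of the inclusion of the category of ordered sets. -/
def linInclusion : Free k SimplexCategory ⥤ Free k BA :=
  freeFunctor (simplexToBA ⋙ Free.embedding k BA)

instance : (linInclusion k).Additive := inferInstanceAs (freeFunctor _).Additive

instance : (linInclusion k).Linear k := inferInstanceAs ((freeFunctor _).Linear k)

theorem linInclusion_map {a b : SimplexCategory} (f : a ⟶ b) :
    (linInclusion k).map ((linearized k (𝟭 SimplexCategory)).map f) =
      (linearized k simplexToBA).map f :=
  freeFunctor_map_embedding (simplexToBA ⋙ Free.embedding k BA) f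

theorem linInclusion_map_normalizerAux {n : ℕ} (j : ℕ) (h : j ≤ n + 1) :
    (linInclusion k).map (normalizerAux (linearized k (𝟭 SimplexCategory)) j h) =
      normalizerAux (linearized k simplexToBA) j h := by
  induction j with
  | zero => exact (linInclusion k).map_id _
  | succ j ih =>
    rw [normalizerAux, normalizerAux, Functor.map_comp, ih, normalizerStep, Functor.map_sub,
      Functor.map_comp]
    refine congrArg (· ≫ _) ?_
    exact congrArg₂ (· - ·) ((linInclusion k).map_id _)
      (congrArg₂ (· ≫ ·) (linInclusion_map k _) (linInclusion_map k _))

theorem linInclusion_map_normalizer (n : ℕ) :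
    (linInclusion k).map (normalizer (linearized k (𝟭 SimplexCategory)) n) =
      normalizer (linearized k simplexToBA) n := by
  cases n with
  | zero => exact (linInclusion k).map_id _
  | succ n => exact linInclusion_map_normalizerAux k _ _

theorem linInclusion_map_objD (n : ℕ) :
    (linInclusion k).map (objD (linearized k (𝟭 SimplexCategory)) n) =
      objD (linearized k simplexToBA) n := by
  rw [objD, Functor.map_sum]
  refine Finset.sum_congr rfl fun i _ => ?_
  rw [Functor.map_zsmul]
  exact congrArg (_ • ·) (linInclusion_map k _)

/-- The functor between the normalized categories that is induced by the inclusion of the category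
of ordered sets. -/
def normalizedMap : Normalized k (𝟭 SimplexCategory) ⥤ Normalized k simplexToBA where
  obj n := n
  map {m n} f := ⟨⟨(linInclusion k).map f.hom.f, by
    have := congrArg (linInclusion k).map f.hom.comm
    rw [Functor.map_comp, Functor.map_comp] at this
    refine Eq.trans ?_ this
    exact congrArg₂ (· ≫ ·) (linInclusion_map_normalizer k m).symm
      (congrArg (_ ≫ ·) (linInclusion_map_normalizer k n).symm)⟩⟩
  map_id n := normalized_hom_ext (linInclusion_map_normalizer k n)
  map_comp f g := normalized_hom_ext ((linInclusion k).map_comp _ _)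

instance : (normalizedMap k).Additive where
  map_add := normalized_hom_ext ((linInclusion k).map_add)

instance : (normalizedMap k).Linear k where
  map_smul _ _ := normalized_hom_ext ((linInclusion k).map_smul _ _)

theorem normalizedMap_map_nD (n : ℕ) :
    (normalizedMap k).map (nD k (𝟭 SimplexCategory) n) = nD k simplexToBA n := by
  apply normalized_hom_ext
  refine (congrArg (linInclusion k).map (nD_hom_f k (𝟭 SimplexCategory) n)).trans ?_
  rw [nD_hom_f, Functor.map_comp]
  exact congrArg₂ (· ≫ ·) (linInclusion_map_normalizer k n) (linInclusion_map_objD k n)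

theorem simplexReversal_nT (n : ℕ) :
    (simplexReversal k).nT n = 𝟙 (nObj k (𝟭 SimplexCategory) n) := by
  apply normalized_hom_ext
  rw [SignedReversal.nT_hom_f]
  exact Category.comp_id _

end NormalizedMap

/-! ### Modules over the normalized category of ordered sets and complexes -/

section CochainEquivalence

variable (k : Type u) [CommRing k]

variable {k} in
/-- The complex of the values of a module over the normalized category of ordered sets. -/
def cochainComplex (F : LinearModules.{u, v} k (Normalized k (𝟭 SimplexCategory))) :
    CochainComplex (ModuleCat.{v} k) ℕ :=
  CochainComplex.of (fun n => F.obj.obj (nObj k _ n))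
    (fun n => F.obj.map (nD k (𝟭 SimplexCategory) n)) fun n => by
      have := F.property.1
      rw [← F.obj.map_comp, nD_comp_nD, F.obj.map_zero]

variable {k} in
theorem cochainComplex_d (F : LinearModules.{u, v} k (Normalized k (𝟭 SimplexCategory)))
    (n : ℕ) : (cochainComplex F).d n (n + 1) = F.obj.map (nD k (𝟭 SimplexCategory) n) :=
  CochainComplex.of_d (fun n => F.obj.obj (nObj k _ n)) (fun n => F.obj.map (nD k _ n)) n

/-- The functor that sends a module over the normalized category of ordered sets to the complex
of its values. -/
def cochainFunctor : LinearModules.{u, v} k (Normalized k (𝟭 SimplexCategory)) ⥤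
    CochainComplex (ModuleCat.{v} k) ℕ where
  obj F := cochainComplex F
  map {F G} η := CochainComplex.ofHom (X := cochainComplex F) (Y := cochainComplex G)
    (fun n => η.hom.app (nObj k _ n)) fun n => by
      rw [cochainComplex_d, cochainComplex_d]
      exact (η.hom.naturality _).symm

instance : (cochainFunctor.{u, v} k).Additive where

instance : (cochainFunctor.{u, v} k).Linear k where

instance : (cochainFunctor.{u, v} k).Faithful where
  map_injective {F G} η θ h := by
    apply ObjectProperty.hom_ext
    ext1
    funext n
    exact congrArg (fun t => t.f n) h

instance : (cochainFunctor.{u, v} k).Full where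
  map_surjective {F G} θ := by
    have := F.property.1
    have := F.property.2
    have := G.property.1
    have := G.property.2
    refine ⟨ObjectProperty.homMk ⟨θ.f, fun m n f =>
      naturality_of_generators (simplexReversal k) θ.f (fun n => ?_) (fun n => ?_) f⟩, rfl⟩
    · rw [simplexReversal_nT]
      exact ((congrArg (· ≫ _) (F.obj.map_id _)).trans (Category.id_comp _)).trans
        ((Category.comp_id _).symm.trans (congrArg (_ ≫ ·) (G.obj.map_id _).symm))
    · have := θ.comm n (n + 1)
      erw [cochainComplex_d, cochainComplex_d] at this
      exact this.symm

variable {k} in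
/-- A complex of modules, with the trivial action of `C₂`. -/
def trivialComplex (V : CochainComplex (ModuleCat.{v} k) ℕ) : TwofoldComplexes.{u, v} k where
  obj :=
    { X := fun n => Rep.trivial k C₂ (V.X n)
      d := fun m n => c₂Hom (A := Rep.trivial k C₂ (V.X m)) (B := Rep.trivial k C₂ (V.X n))
        (V.d m n).hom fun _ => rfl
      shape := fun m n h => rep_hom_ext fun x => module_hom_congr (V.shape m n h) x
      d_comp_d' := fun l m n _ _ => rep_hom_ext fun x => module_hom_congr (V.d_comp_d l m n) x }
  property := inferInstanceAs (Representation.trivial k C₂ (V.X 0)).IsTrivial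

instance : (cochainFunctor.{u, v} k).EssSurj where
  mem_essImage V := by
    let W := trivialComplex V
    let M := moduleOfComplex W.obj W.property
    refine ⟨(restrictModules k (normalizedMap k)).obj M,
      ⟨HomologicalComplex.Hom.isoOfComponents (fun n => Iso.refl _) ?_⟩⟩
    rintro m _ rfl
    refine (Category.id_comp _).trans (Eq.trans ?_ (Category.comp_id _).symm)
    refine Eq.trans ?_ (cochainComplex_d ((restrictModules k (normalizedMap k)).obj M) m).symm
    refine Eq.trans ?_ (congrArg M.obj.map (normalizedMap_map_nD k m)).symm
    ext x
    exact (congrArg (fun t => t.hom x) (nAction_nD W.obj m)).symm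

end CochainEquivalence

/-! ### Modules over the normalized category without its first object -/

section Positive

variable (k : Type u) [CommRing k]

/-- The objects of the normalized category without its first object. -/
abbrev pObj (n : ℕ) (h : n ≠ 0) : NormalizedPos k (𝟭 SimplexCategory) := ⟨nObj k _ n, h⟩

/-- The differentials of the normalized category without its first object. -/
abbrev pD (n : ℕ) (h : n ≠ 0) : pObj k n h ⟶ pObj k (n + 1) n.succ_ne_zero :=
  ObjectProperty.homMk (nD k (𝟭 SimplexCategory) n)

variable {k} in
/-- The complex of the values of a module over the normalized category of ordered sets without its
first object. -/
def posCochainComplex (F : LinearModules.{u, v} k (NormalizedPos k (𝟭 SimplexCategory))) :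
    CochainComplex (ModuleCat.{v} k) ℕ :=
  CochainComplex.of (fun n => F.obj.obj (pObj k (n + 1) n.succ_ne_zero))
    (fun n => F.obj.map (pD k (n + 1) n.succ_ne_zero)) fun n => by
      have := F.property.1
      have h : pD k (n + 1) n.succ_ne_zero ≫ pD k (n + 1 + 1) (n + 1).succ_ne_zero = 0 :=
        ObjectProperty.hom_ext _ (nD_comp_nD k (𝟭 SimplexCategory) (n + 1))
      rw [← F.obj.map_comp, h, F.obj.map_zero]

variable {k} in
theorem posCochainComplex_d
    (F : LinearModules.{u, v} k (NormalizedPos k (𝟭 SimplexCategory))) (n : ℕ) :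
    (posCochainComplex F).d n (n + 1) = F.obj.map (pD k (n + 1) n.succ_ne_zero) :=
  CochainComplex.of_d (fun n => F.obj.obj (pObj k (n + 1) n.succ_ne_zero))
    (fun n => F.obj.map (pD k (n + 1) n.succ_ne_zero)) n

/-- The functor that sends a module over the normalized category of ordered sets without its
first object to the complex of its values. -/
def posCochainFunctor : LinearModules.{u, v} k (NormalizedPos k (𝟭 SimplexCategory)) ⥤
    CochainComplex (ModuleCat.{v} k) ℕ where
  obj F := posCochainComplex F
  map {F G} η := CochainComplex.ofHom (X := posCochainComplex F) (Y := posCochainComplex G)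
    (fun n => η.hom.app (pObj k (n + 1) n.succ_ne_zero)) fun n => by
      rw [posCochainComplex_d, posCochainComplex_d]
      exact (η.hom.naturality _).symm

instance : (posCochainFunctor.{u, v} k).Additive where

instance : (posCochainFunctor.{u, v} k).Linear k where

instance : (posCochainFunctor.{u, v} k).Faithful where
  map_injective {F G} η θ h := by
    apply ObjectProperty.hom_ext
    ext1
    funext X
    obtain ⟨n, hn⟩ := X
    obtain ⟨m, rfl⟩ := Nat.exists_eq_succ_of_ne_zero hn
    exact congrArg (fun t => t.f m) h

variable {k} in
theorem pos_naturality_of_generators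
    {F G : NormalizedPos k (𝟭 SimplexCategory) ⥤ ModuleCat.{v} k} [F.Additive] [G.Additive]
    [F.Linear k] [G.Linear k] (η : ∀ (n : ℕ) (h : n ≠ 0), F.obj (pObj k n h) ⟶ G.obj (pObj k n h))
    (hD : ∀ n h, F.map (pD k n h) ≫ η (n + 1) n.succ_ne_zero = η n h ≫ G.map (pD k n h)) {m n : ℕ}
    (hm : m ≠ 0) (hn : n ≠ 0) (f : nObj k (𝟭 SimplexCategory) m ⟶ nObj k (𝟭 SimplexCategory) n) :
    F.map (ObjectProperty.homMk f : pObj k m hm ⟶ pObj k n hn) ≫ η n hn =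
      η m hm ≫ G.map (ObjectProperty.homMk f : pObj k m hm ⟶ pObj k n hn) := by
  induction (simplexReversal k).mem_span_isBasic f using Submodule.span_induction with
  | zero =>
    have h : (ObjectProperty.homMk 0 : pObj k m hm ⟶ pObj k n hn) = 0 := rfl
    rw [h, F.map_zero, G.map_zero, Limits.zero_comp, Limits.comp_zero]
  | add a b _ _ ha hb =>
    have h : (ObjectProperty.homMk (a + b) : pObj k m hm ⟶ pObj k n hn) =
      ObjectProperty.homMk a + ObjectProperty.homMk b := rfl
    rw [h, F.map_add, G.map_add, Preadditive.add_comp, ha, hb, Preadditive.comp_add]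
  | smul r a _ ha =>
    have h : (ObjectProperty.homMk (r • a) : pObj k m hm ⟶ pObj k n hn) =
      r • ObjectProperty.homMk a := rfl
    rw [h, F.map_smul, G.map_smul, Linear.smul_comp, ha, Linear.comp_smul]
  | mem a ha =>
    have hid : ∀ l hl, F.map (𝟙 (pObj k l hl)) ≫ η l hl = η l hl ≫ G.map (𝟙 (pObj k l hl)) :=
      fun l hl => by rw [F.map_id, G.map_id, Category.id_comp, Category.comp_id]
    cases ha with
    | id => exact hid _ _
    | nT =>
      rw [simplexReversal_nT]
      exact hid _ _
    | nD => exact hD _ _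
    | nT_nD =>
      rw [simplexReversal_nT, Category.id_comp]
      exact hD _ _

instance : (posCochainFunctor.{u, v} k).Full where
  map_surjective {F G} θ := by
    have := F.property.1
    have := F.property.2
    have := G.property.1
    have := G.property.2
    let η : ∀ (n : ℕ) (h : n ≠ 0), F.obj.obj (pObj k n h) ⟶ G.obj.obj (pObj k n h) := fun n h =>
      Nat.casesOn (motive := fun n => ∀ h : n ≠ 0, F.obj.obj (pObj k n h) ⟶ G.obj.obj (pObj k n h))
        n (fun h => (h rfl).elim) (fun n _ => θ.f n) h
    refine ⟨ObjectProperty.homMk ⟨fun X => η X.obj X.property, fun X Y f =>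
      pos_naturality_of_generators η (fun n h => ?_) X.property Y.property f.hom⟩, rfl⟩
    obtain ⟨m, rfl⟩ := Nat.exists_eq_succ_of_ne_zero h
    have := θ.comm m (m + 1)
    erw [posCochainComplex_d, posCochainComplex_d] at this
    exact this.symm

instance : (posCochainFunctor.{u, v} k).EssSurj where
  mem_essImage V := by
    let W := CochainComplex.augment V (0 : V.X 0 ⟶ V.X 0) Limits.zero_comp
    let M := (cochainFunctor k).objPreimage W
    let e : (cochainFunctor k).obj M ≅ W := (cochainFunctor k).objObjPreimageIso W
    have : (ObjectProperty.ι (C := Normalized k (𝟭 SimplexCategory))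
      fun n : ℕ => n ≠ 0).Additive := { map_add := rfl }
    have : (ObjectProperty.ι (C := Normalized k (𝟭 SimplexCategory))
      fun n : ℕ => n ≠ 0).Linear k := { map_smul := fun _ _ => rfl }
    let N := (restrictModules k (ObjectProperty.ι (C := Normalized k (𝟭 SimplexCategory))
      fun n : ℕ => n ≠ 0)).obj M
    refine ⟨N, ⟨(HomologicalComplex.Hom.isoOfComponents (fun n => Iso.refl _) ?_ :
      (posCochainFunctor k).obj N ≅ CochainComplex.truncate.obj ((cochainFunctor k).obj M)) ≪≫
      CochainComplex.truncate.mapIso e ≪≫ CochainComplex.truncateAugment V _ _⟩⟩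
    rintro m _ rfl
    refine (Category.id_comp _).trans (Eq.trans ?_ (Category.comp_id _).symm)
    exact (cochainComplex_d M (m + 1)).trans (posCochainComplex_d N m).symm

end Positive

/-! ### Eigenspaces of the action of the group with two elements -/

section Eigenspaces

variable {k : Type u} [CommRing k]

/-- The eigenspace of the generator of `C₂` for the eigenvalue `ε`. -/
def eigenspace (ε : k) (A : Rep.{v} k C₂) : Submodule k A where
  carrier := {x | A.ρ γ x = ε • x}
  add_mem' {x y} hx hy := by
    simp only [Set.mem_ofPred_eq] at hx hy ⊢
    rw [map_add, hx, hy, smul_add]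
  zero_mem' := by simp
  smul_mem' c x hx := by
    simp only [Set.mem_ofPred_eq] at hx ⊢
    rw [map_smul, hx, smul_comm]

theorem rep_hom_γ {A B : Rep.{v} k C₂} (f : A ⟶ B) (x : A) :
    f.hom (A.ρ γ x) = B.ρ γ (f.hom x) :=
  LinearMap.congr_fun (f.hom.isIntertwining' γ) x

variable (k) in
/-- The functor of eigenspaces of the generator of `C₂` for the eigenvalue `ε`. -/
def eigenFunctor (ε : k) : Rep.{v} k C₂ ⥤ ModuleCat.{v} k where
  obj A := ModuleCat.of k (eigenspace ε A)
  map {A B} f := ModuleCat.ofHom (f.hom.toLinearMap.restrict fun x hx =>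
    (rep_hom_γ f x).symm.trans ((congrArg f.hom hx).trans (map_smul f.hom.toLinearMap ε x)))

instance (ε : k) : (eigenFunctor.{u, v} k ε).Additive where

/-- When `2 * c = 1`, this is the projection onto the eigenspace for the eigenvalue `ε = ±1`. -/
def eigenProjection (c ε : k) (h : ε * ε = 1) (A : Rep.{v} k C₂) : A →ₗ[k] eigenspace ε A :=
  (c • (LinearMap.id + ε • A.ρ γ)).codRestrict _ fun x => by
    change A.ρ γ (c • (x + ε • A.ρ γ x)) = ε • c • (x + ε • A.ρ γ x)
    rw [map_smul, map_add, map_smul, rep_γ_γ, smul_comm ε c, smul_add ε, smul_smul ε ε, h, one_smul,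
      add_comm]

theorem eigenProjection_add {c : k} (hc : 2 * c = 1) {A : Rep.{v} k C₂} (x : A) :
    (eigenProjection c 1 (one_mul 1) A x : A) + eigenProjection c (-1) (by ring) A x = x := by
  change c • (x + (1 : k) • A.ρ γ x) + c • (x + (-1 : k) • A.ρ γ x) = x
  calc
    _ = (2 * c) • x := by module
    _ = x := by rw [hc, one_smul]

theorem eigenProjection_self {c ε : k} (hc : 2 * c = 1) (h : ε * ε = 1) {A : Rep.{v} k C₂} {x : A}
    (hx : x ∈ eigenspace ε A) : eigenProjection c ε h A x = ⟨x, hx⟩ := by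
  apply Subtype.ext
  change c • (x + ε • A.ρ γ x) = x
  rw [show A.ρ γ x = ε • x from hx, smul_smul, h, one_smul, ← two_smul k x, smul_smul, mul_comm, hc,
    one_smul]

theorem eigenProjection_of_neg {c ε ε' : k} (h : ε * ε = 1) (hε : ε * ε' = -1) {A : Rep.{v} k C₂}
    {x : A} (hx : x ∈ eigenspace ε' A) : eigenProjection c ε h A x = 0 := by
  apply Subtype.ext
  change c • (x + ε • A.ρ γ x) = 0
  rw [show A.ρ γ x = ε' • x from hx, smul_smul, hε, neg_one_smul, add_neg_cancel, smul_zero]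

theorem rep_hom_ext_eigen {c : k} (hc : 2 * c = 1) {A B : Rep.{v} k C₂} {f g : A ⟶ B}
    (h₁ : (eigenFunctor k 1).map f = (eigenFunctor k 1).map g)
    (h₂ : (eigenFunctor k (-1)).map f = (eigenFunctor k (-1)).map g) : f = g := by
  refine rep_hom_ext fun x => ?_
  have e₁ := congrArg Subtype.val (module_hom_congr h₁ (eigenProjection c 1 (one_mul 1) A x))
  have e₂ := congrArg Subtype.val (module_hom_congr h₂ (eigenProjection c (-1) (by ring) A x))
  rw [← eigenProjection_add hc x]
  exact (map_add f.hom.toLinearMap _ _).trans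
    ((congrArg₂ (· + ·) e₁ e₂).trans (map_add g.hom.toLinearMap _ _).symm)

/-- The map of representations with given restrictions to the two eigenspaces. -/
def glueHom (c : k) {A B : Rep.{v} k C₂} (g₁ : eigenspace 1 A →ₗ[k] eigenspace 1 B)
    (g₂ : eigenspace (-1) A →ₗ[k] eigenspace (-1) B) : A ⟶ B :=
  c₂Hom
    ((eigenspace 1 B).subtype ∘ₗ g₁ ∘ₗ eigenProjection c 1 (one_mul 1) A +
      (eigenspace (-1) B).subtype ∘ₗ g₂ ∘ₗ eigenProjection c (-1) (by ring) A)
    fun x => by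
      have h₁ : eigenProjection c 1 (one_mul 1) A (A.ρ γ x) =
          (1 : k) • eigenProjection c 1 (one_mul 1) A x := by
        apply Subtype.ext
        change c • (A.ρ γ x + (1 : k) • A.ρ γ (A.ρ γ x)) = (1 : k) • c • (x + (1 : k) • A.ρ γ x)
        rw [rep_γ_γ]
        module
      have h₂ : eigenProjection c (-1) (by ring) A (A.ρ γ x) =
          (-1 : k) • eigenProjection c (-1) (by ring) A x := by
        apply Subtype.ext
        change c • (A.ρ γ x + (-1 : k) • A.ρ γ (A.ρ γ x)) =
          (-1 : k) • c • (x + (-1 : k) • A.ρ γ x)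
        rw [rep_γ_γ]
        module
      have e₁ := (g₁ (eigenProjection c 1 (one_mul 1) A x)).2
      have e₂ := (g₂ (eigenProjection c (-1) (by ring) A x)).2
      simp only [LinearMap.add_apply, LinearMap.comp_apply, map_add, h₁, h₂, map_smul]
      exact congrArg₂ (· + ·) e₁.symm e₂.symm

theorem eigenFunctor_map_glueHom_one {c : k} (hc : 2 * c = 1) {A B : Rep.{v} k C₂}
    (g₁ : eigenspace 1 A →ₗ[k] eigenspace 1 B) (g₂ : eigenspace (-1) A →ₗ[k] eigenspace (-1) B) :
    (eigenFunctor k 1).map (glueHom c g₁ g₂) = ModuleCat.ofHom g₁ := by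
  ext x
  apply Subtype.ext
  change (g₁ (eigenProjection c 1 (one_mul 1) A x.1) : B) +
    g₂ (eigenProjection c (-1) (by ring) A x.1) = g₁ x
  rw [eigenProjection_self hc _ x.2, eigenProjection_of_neg _ (by ring) x.2,
    map_zero, ZeroMemClass.coe_zero, add_zero]
  rfl

theorem eigenFunctor_map_glueHom_neg_one {c : k} (hc : 2 * c = 1) {A B : Rep.{v} k C₂}
    (g₁ : eigenspace 1 A →ₗ[k] eigenspace 1 B) (g₂ : eigenspace (-1) A →ₗ[k] eigenspace (-1) B) :
    (eigenFunctor k (-1)).map (glueHom c g₁ g₂) = ModuleCat.ofHom g₂ := by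
  ext x
  apply Subtype.ext
  change (g₁ (eigenProjection c 1 (one_mul 1) A x.1) : B) +
    g₂ (eigenProjection c (-1) (by ring) A x.1) = g₂ x
  rw [eigenProjection_self hc _ x.2, eigenProjection_of_neg _ (by ring) x.2,
    map_zero, ZeroMemClass.coe_zero, zero_add]
  rfl

/-- The representation with given eigenspaces for the eigenvalues `1` and `-1`. -/
def pairRep (A B : ModuleCat.{v} k) : Rep.{v} k C₂ :=
  c₂Rep (A := A × B) (LinearMap.prodMap LinearMap.id (-LinearMap.id)) fun x =>
    Prod.ext rfl (neg_neg x.2)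

theorem pairRep_ρ_γ (A B : ModuleCat.{v} k) (x : A × B) :
    (pairRep A B).ρ γ x = (x.1, -x.2) := c₂Rep_ρ_γ _ _ x

/-- In a module in which `2` is invertible, only zero is its own opposite. -/
theorem eq_zero_of_eq_neg {c : k} (hc : 2 * c = 1) {M : Type*} [AddCommGroup M] [Module k M] {x : M}
    (h : x = -x) : x = 0 := by
  have h' : (2 : k) • x = 0 := by rw [two_smul]; exact add_eq_zero_iff_eq_neg.2 h
  rw [← one_smul k x, ← hc, mul_comm, mul_smul, h', smul_zero]

/-- The first eigenspace of `pairRep A B` is `A`. -/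
def eigenPairIsoOne {c : k} (hc : 2 * c = 1) (A B : ModuleCat.{v} k) :
    (eigenFunctor k 1).obj (pairRep A B) ≅ A :=
  LinearEquiv.toModuleIso (X₁ := eigenspace 1 (pairRep A B)) (X₂ := A)
    { toFun := fun x => (show A × B from x.1).1
      map_add' := fun _ _ => rfl
      map_smul' := fun _ _ => rfl
      invFun := fun a => ⟨show A × B from (a, 0), (pairRep_ρ_γ A B (a, 0)).trans
        ((congrArg (Prod.mk a) neg_zero).trans (one_smul k (a, (0 : B))).symm)⟩
      left_inv := fun ⟨x, hx⟩ => Subtype.ext <| Prod.ext rfl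
        (eq_zero_of_eq_neg hc (congrArg Prod.snd
          ((one_smul k (show A × B from x)).symm.trans
            (hx.symm.trans (pairRep_ρ_γ A B x))))).symm
      right_inv := fun _ => rfl }

/-- The second eigenspace of `pairRep A B` is `B`. -/
def eigenPairIsoNegOne {c : k} (hc : 2 * c = 1) (A B : ModuleCat.{v} k) :
    (eigenFunctor k (-1)).obj (pairRep A B) ≅ B :=
  LinearEquiv.toModuleIso (X₁ := eigenspace (-1) (pairRep A B)) (X₂ := B)
    { toFun := fun x => (show A × B from x.1).2
      map_add' := fun _ _ => rfl
      map_smul' := fun _ _ => rfl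
      invFun := fun b => ⟨show A × B from (0, b), (pairRep_ρ_γ A B (0, b)).trans
        ((congrArg (Prod.mk · (-b)) neg_zero.symm).trans
          (neg_one_smul k ((0 : A), b)).symm)⟩
      left_inv := fun ⟨x, hx⟩ => Subtype.ext <| Prod.ext
        (eq_zero_of_eq_neg hc (congrArg Prod.fst
          ((pairRep_ρ_γ A B x).symm.trans (hx.trans
            (neg_one_smul k (show A × B from x)))))).symm rfl
      right_inv := fun _ => rfl }

end Eigenspaces

/-! ### Splitting a complex of representations -/

section Splitting

/-- A map between truncated complexes extends when the source starts with zero. -/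
def truncateHomLift {A : Type*} [Category* A] [Preadditive A] {X Y : CochainComplex A ℕ}
    (hX : Limits.IsZero (X.X 0)) (g : CochainComplex.truncate.obj X ⟶ CochainComplex.truncate.obj Y) :
    X ⟶ Y where
  f n := Nat.casesOn (motive := fun n => X.X n ⟶ Y.X n) n 0 g.f
  comm' i j h := by
    obtain rfl : i + 1 = j := h
    cases i with
    | zero => exact hX.eq_of_src _ _
    | succ i => exact g.comm i (i + 1)

variable (k : Type u) [CommRing k]

/-- The complex of the eigenspaces of a complex of representations. -/
abbrev eigenComplex (ε : k) :
    CochainComplex (Rep.{v} k C₂) ℕ ⥤ CochainComplex (ModuleCat.{v} k) ℕ :=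
  (eigenFunctor k ε).mapHomologicalComplex _

/-- The functor that sends a complex of representations to the two complexes of its eigenspaces.
The eigenspace for the eigenvalue `-1` in degree zero is dropped, since it is zero. -/
def splitFunctor : TwofoldComplexes.{u, v} k ⥤
    CochainComplex (ModuleCat.{v} k) ℕ × CochainComplex (ModuleCat.{v} k) ℕ :=
  ObjectProperty.ι _ ⋙ Functor.prod' (eigenComplex k 1) (eigenComplex k (-1) ⋙ CochainComplex.truncate)

instance : (splitFunctor.{u, v} k).Additive where
  map_add := rfl

instance : (splitFunctor.{u, v} k).Linear k where
  map_smul _ _ := rfl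

variable {k}

theorem isZero_eigen_zero {c : k} (hc : 2 * c = 1) (V : TwofoldComplexes.{u, v} k) :
    Limits.IsZero (((eigenComplex k (-1)).obj V.obj).X 0) := by
  have := V.property
  have : Subsingleton (eigenspace (-1 : k) (V.obj.X 0)) := by
    refine subsingleton_of_forall_eq 0 fun ⟨x, hx⟩ => Subtype.ext (eq_zero_of_eq_neg hc ?_)
    have h : (V.obj.X 0).ρ γ x = x := Representation.isTrivial_apply _ _ _
    exact h.symm.trans (hx.trans (neg_one_smul k x))
  exact ModuleCat.isZero_of_subsingleton (ModuleCat.of k (eigenspace (-1 : k) (V.obj.X 0)))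

theorem splitFunctor_faithful {c : k} (hc : 2 * c = 1) : (splitFunctor.{u, v} k).Faithful where
  map_injective {V W} f g h := by
    apply ObjectProperty.hom_ext
    ext1 n
    refine rep_hom_ext_eigen hc (congrArg (fun t => t.1.f n) h) ?_
    cases n with
    | zero => exact (isZero_eigen_zero hc V).eq_of_src _ _
    | succ n => exact congrArg (fun t => t.2.f n) h

theorem splitFunctor_full {c : k} (hc : 2 * c = 1) : (splitFunctor.{u, v} k).Full where
  map_surjective {V W} g := by
    let g₁ : (eigenComplex k 1).obj V.obj ⟶ (eigenComplex k 1).obj W.obj := g.1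
    let g₂ : (eigenComplex k (-1)).obj V.obj ⟶ (eigenComplex k (-1)).obj W.obj :=
      truncateHomLift (isZero_eigen_zero hc V) g.2
    have h₁ n := eigenFunctor_map_glueHom_one hc (g₁.f n).hom (g₂.f n).hom
    have h₂ n := eigenFunctor_map_glueHom_neg_one hc (g₁.f n).hom (g₂.f n).hom
    refine ⟨ObjectProperty.homMk ⟨fun n => glueHom c (g₁.f n).hom (g₂.f n).hom, fun m n _ =>
      rep_hom_ext_eigen hc ?_ ?_⟩, Prod.ext ?_ ?_⟩
    · rw [Functor.map_comp, Functor.map_comp, h₁, h₁]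
      exact g₁.comm m n
    · rw [Functor.map_comp, Functor.map_comp, h₂, h₂]
      exact g₂.comm m n
    · ext1 n
      exact h₁ n
    · ext1 n
      exact h₂ (n + 1)

/-- The complex of representations with given complexes of eigenspaces. -/
def pairComplex (A B : CochainComplex (ModuleCat.{v} k) ℕ) : CochainComplex (Rep.{v} k C₂) ℕ where
  X n := pairRep (A.X n) (B.X n)
  d m n := c₂Hom (A := pairRep (A.X m) (B.X m)) (B := pairRep (A.X n) (B.X n))
    (LinearMap.prodMap (A.d m n).hom (B.d m n).hom) fun x => by
      refine (congrArg _ (pairRep_ρ_γ _ _ x)).trans (Eq.trans ?_ (pairRep_ρ_γ _ _ _).symm)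
      exact Prod.ext rfl (map_neg (B.d m n).hom _)
  shape m n h := rep_hom_ext fun x =>
    Prod.ext (module_hom_congr (A.shape m n h) _) (module_hom_congr (B.shape m n h) _)
  d_comp_d' l m n _ _ := rep_hom_ext fun x =>
    Prod.ext (module_hom_congr (A.d_comp_d l m n) _) (module_hom_congr (B.d_comp_d l m n) _)

theorem splitFunctor_essSurj {c : k} (hc : 2 * c = 1) : (splitFunctor.{u, v} k).EssSurj where
  mem_essImage := by
    rintro ⟨A, B⟩
    -- A zero module in front of `B` makes the action trivial in degree zero.
    let B' := CochainComplex.augment B (0 : ModuleCat.of k PUnit.{v + 1} ⟶ B.X 0) Limits.zero_comp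
    let W : TwofoldComplexes.{u, v} k := ⟨pairComplex A B', isTrivial_of_γ
      (A := pairRep (A.X 0) (B'.X 0)) fun x => (pairRep_ρ_γ _ _ x).trans
        (Prod.ext rfl (Subsingleton.elim (α := PUnit) _ _))⟩
    let e₁ : (eigenComplex k 1).obj W.obj ≅ A :=
      HomologicalComplex.Hom.isoOfComponents (fun n => eigenPairIsoOne hc (A.X n) (B'.X n))
        fun _ _ _ => rfl
    let e₂ : (eigenComplex k (-1)).obj W.obj ≅ B' :=
      HomologicalComplex.Hom.isoOfComponents (fun n => eigenPairIsoNegOne hc (A.X n) (B'.X n))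
        fun _ _ _ => rfl
    exact ⟨W, ⟨Iso.prod e₁ (CochainComplex.truncate.mapIso e₂ ≪≫
      CochainComplex.truncateAugment B _ _)⟩⟩

/-- When `2` is invertible, a representation of `C₂` is the direct sum of its eigenspaces for the
eigenvalues `1` and `-1`, and so is a complex of representations. -/
theorem linearlyEquivalent_split (h : IsUnit (2 : k)) :
    LinearlyEquivalent k (TwofoldComplexes.{u, v} k)
      (CochainComplex (ModuleCat.{v} k) ℕ × CochainComplex (ModuleCat.{v} k) ℕ) := by
  obtain ⟨c, hc⟩ := h.exists_right_inv
  have := splitFunctor_faithful.{u, v} hc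
  have := splitFunctor_full.{u, v} hc
  have := splitFunctor_essSurj.{u, v} hc
  exact .of_functor (splitFunctor k)

theorem linearlyEquivalent_twofold_prod (h : IsUnit (2 : k)) :
    LinearlyEquivalent k (TwofoldComplexes.{u, v} k)
      (LinearModules.{u, v} k (Normalized k (𝟭 SimplexCategory)) ×
        LinearModules.{u, v} k (NormalizedPos k (𝟭 SimplexCategory))) :=
  (linearlyEquivalent_split h).trans
    (.symm (.prod (.of_functor (cochainFunctor k)) (.of_functor (posCochainFunctor k))))

instance : simplexToBA.EssSurj where
  mem_essImage X := ⟨⦋X.len⦌, ⟨Iso.refl _⟩⟩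

theorem linearlyEquivalent_twofold (k : Type u) [CommRing k] :
    LinearlyEquivalent k (BA ⥤ ModuleCat.{v} k) (TwofoldComplexes.{u, v} k) :=
  (linearlyEquivalent_normalized k simplexToBA).trans (.of_functor (twofoldFunctor k))

end Splitting

end DoldKanBA

end

theorem mainTheorem10 (k : Type u) [CommRing k] :
    DoldKanBA.LinearlyEquivalent k (DoldKanBA.BA ⥤ ModuleCat.{v} k)
      (DoldKanBA.TwofoldComplexes.{u, v} k) ∧
    (IsUnit (2 : k) →
      DoldKanBA.LinearlyEquivalent k
        (DoldKanBA.LinearModules.{u, v} k (DoldKanBA.Normalized k DoldKanBA.simplexToBA))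
        (DoldKanBA.LinearModules.{u, v} k (DoldKanBA.Normalized k (𝟭 SimplexCategory)) ×
          DoldKanBA.LinearModules.{u, v} k (DoldKanBA.NormalizedPos k (𝟭 SimplexCategory))) ∧
      DoldKanBA.LinearlyEquivalent k (DoldKanBA.BA ⥤ ModuleCat.{v} k)
        (DoldKanBA.LinearModules.{u, v} k (DoldKanBA.Normalized k (𝟭 SimplexCategory)) ×
          DoldKanBA.LinearModules.{u, v} k (DoldKanBA.NormalizedPos k (𝟭 SimplexCategory)))) :=
  ⟨DoldKanBA.linearlyEquivalent_twofold k, fun h =>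
    ⟨.trans (.of_functor (DoldKanBA.twofoldFunctor k))
      (DoldKanBA.linearlyEquivalent_twofold_prod h),
      (DoldKanBA.linearlyEquivalent_twofold k).trans
        (DoldKanBA.linearlyEquivalent_twofold_prod h)⟩⟩
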